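/- Let $N\ge 2$, $\omega=e^{2\pi i/N}$, $X=\sum_\ell|\ell\rangle\langle\ell+1|$ (mod $N$), $Z=\sum_\ell\omega^\ell|\ell\rangle\langle\ell|$, and let the Heisenberg–Weyl operators be $X^iZ^j$, $0\le i,j<N$; those with $(i,j)\neq(0,0)$ are written $W_\alpha$ ($N^2-1$ labels $\alpha$). Consider the $SU(N)$ AKLT state on an open chain of $n$ sites: each site carries $\mathbf N\otimes\bar{\mathbf N}$, the $\bar{\mathbf N}$ spin of each site forms a singlet with the $\mathbf N$ spin of the next one, the $\mathbf N$ spin of the first site is in an edge state $|\psi\rangle\in\mathbb C^N$, the $\bar{\mathbf N}$ spin of the last site forms a singlet with one free $\mathbf N$ spin (the virtual system), and every site is then projected onto the adjoint irrep $\mathbf{N^2-1}\subset\mathbf N\otimes\bar{\mathbf N}$ and the state multiplied by $(N/\sqrt{N^2-1})^n$. Sites are measured one after the other in orthonormal bases of the on-site space, each basis possibly depending on the earlier outcomes. Then: 1. The state is normalized if $\psi$ is. A measurement of the sites multiplies $|\psi\rangle$, on the virtual space, by the product of the Kraus operators of the outcomes (first site acting first), where a unit vector $T=\sum T_{lr}|l\rangle|r\rangle$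 of the on-site space has Kraus operator $\sqrt{N/(N^2-1)}\,T^\dagger$. 2. The vectors $\sqrt2 M_\beta$, with $M_\beta$ the generalized Gell-Mann matrices ($\operatorname{tr}M_\beta M_\gamma=\delta_{\beta\gamma}/2$), form an on-site orthonormal basis with Kraus operators $A_\beta=\sqrt{2N/(N^2-1)}\,M_\beta$, and there is a unitary $(u_{\alpha\beta})$ with $\sum_\beta u_{\alpha\beta}A_\beta=W_\alpha/\sqrt{N^2-1}$. The $X^iZ^j$ are unitary. 3. For every unitary $V$, the on-site basis with vectors $N^{-1/2}V^\dagger W_\alpha^\dagger V$ (the Heisenberg–Weyl basis rotated by the on-site symmetry) is orthonormal and has the Kraus operators $V^\dagger W_\alpha V/\sqrt{N^2-1}=W_\alpha G_\alpha(V)/\sqrt{N^2-1}$, where $G_\alpha(V)=W_\alpha^\dagger V^\dagger W_\alpha V$ is the gate induced by outcome $\alpha$, with byproduct $W_\alpha$. Call $V$ elementary if $V=e^{i\theta|\lambda\rangle\langle\lambda|}$ with $\theta\in\mathbb R$ and $|\lambda\rangle$ a unit eigenvector of one of $Z,X,XZ,X^2Z,\dots,X^{N-1}Z$, and consider adaptive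 schemes in which each site is measured in the basis of part 3 for an elementary $V$ chosen from the earlier outcomes. 4. (Gates and byproducts) For every such scheme and every unit $\psi$, each sequence of outcomes on $n$ sites has probability $(N^2-1)^{-n}$; and for each sequence of outcomes there are $G\in SU(N)$, $i$, $j$ and a scalar $c\ne0$ such that it acts on the virtual space, for all $\psi$, as $c\,X^iZ^jG$. 5. (Success probability) For elementary $V$, $G_\alpha(V)\in SU(N)$, and $G_\alpha(V)=\mathbb 1$ if and only if $V$ commutes with $W_\alpha$; if $G_\alpha(V)\neq\mathbb 1$ and ($N>2$ or $V^2\ne\mathbb 1$), then $G_\alpha(V)$ is not a scalar either. If the $V$ used at a site is not $\mathbb 1$, then, conditionally on any earlier outcomes and for every unit $\psi$, the measurement of that site induces a nontrivial gate $G_\alpha(V)\ne\mathbb 1$ with probability exactly $N/(N+1)$. 6. (All of $SU(N)$) For every $T\in SU(N)$ and every $\varepsilon>0$ there are such a scheme, a number $n$ of sites, and a set of outcome sequences, each of which acts on the virtual space as $c\,X^iZ^jT$ with a scalar $c\neq0$ and exponents $i,j$ determined by the outcomes, whose total probability is at least $1-\varepsilon$ for every unit $\psi$. -/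

import Mathlib

open scoped Matrix

noncomputable section

namespace AKLT

/-- The `N² - 1` labels: pairs in `{0, …, N-1}²` other than `(0, 0)`. -/
abbrev Label (N : ℕ) : Type :=
  {p : Fin N × Fin N // ¬ (p.1.val = 0 ∧ p.2.val = 0)}

/-! ### Heisenberg–Weyl operators -/

/-- The shift `X = ∑ ℓ, |ℓ⟩⟨ℓ + 1|` (indices modulo `N`). -/
def shiftX (N : ℕ) : Matrix (Fin N) (Fin N) ℂ :=
  Matrix.of fun a b => if b.val = (a.val + 1) % N then 1 else 0

/-- The clock `Z = ∑ ℓ, ω ^ ℓ |ℓ⟩⟨ℓ|`, `ω = exp (2πi / N)`. -/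
def clockZ (N : ℕ) : Matrix (Fin N) (Fin N) ℂ :=
  Matrix.diagonal fun l => Complex.exp (2 * Real.pi * Complex.I / N) ^ l.val

/-- The Heisenberg–Weyl operator `X ^ i Z ^ j`. -/
def hw (N : ℕ) (p : Fin N × Fin N) : Matrix (Fin N) (Fin N) ℂ :=
  shiftX N ^ p.1.val * clockZ N ^ p.2.val

/-! ### Generalized Gell-Mann matrices, normalized by `tr (M_a M_b) = δ_ab / 2` -/

/-- The label `(i, j)` stands for the symmetric matrix `X_ij` if `i < j`, for the antisymmetric
matrix `Y_ji` if `j < i`, and for the `i`-th diagonal matrix if `i = j ≥ 1`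
(all indices start at `0`). -/
def gellMann (N : ℕ) (b : Label N) : Matrix (Fin N) (Fin N) ℂ :=
  let i := b.1.1
  let j := b.1.2
  if i < j then
    (1 / 2 : ℂ) • (Matrix.single i j 1 + Matrix.single j i 1)
  else if j < i then
    (-Complex.I / 2) • (Matrix.single j i 1 - Matrix.single i j 1)
  else
    ((1 / Real.sqrt (2 * (i.val + 1) * i.val) : ℝ) : ℂ) •
      ((∑ l : Fin N with l < i, Matrix.single l l 1) - (i.val : ℂ) • Matrix.single i i 1)

/-! ### One site: two virtual spins `N ⊗ N̄ = (N² - 1) ⊕ 1` -/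

/-- The space `ℂ^N ⊗ ℂ^N` carrying `N ⊗ N̄`: a vector has components `T (l, r)`, the index `l`
belonging to `N` and the index `r` to `N̄`. -/
abbrev PairSpace (N : ℕ) : Type := EuclideanSpace ℂ (Fin N × Fin N)

/-- The vector with components the entries of a matrix. -/
def toPair (N : ℕ) (T : Matrix (Fin N) (Fin N) ℂ) : PairSpace N :=
  WithLp.toLp 2 fun p => T p.1 p.2

/-- The matrix with entries the components of a vector. -/
def toMat (N : ℕ) (T : PairSpace N) : Matrix (Fin N) (Fin N) ℂ :=
  Matrix.of fun l r => T (l, r)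

/-- The normalized singlet `∑ m, |m⟩ ⊗ |m⟩ / √N` of `N ⊗ N̄`. -/
def singlet (N : ℕ) : PairSpace N :=
  WithLp.toLp 2 fun p => if p.1 = p.2 then ((1 / Real.sqrt N : ℝ) : ℂ) else 0

/-- The on-site Hilbert space: the orthogonal complement of the singlet in `N ⊗ N̄`, which carries
the adjoint irrep of dimension `N² - 1`. -/
def adjointSpace (N : ℕ) : Submodule ℂ (PairSpace N) :=
  (Submodule.span ℂ {singlet N})ᗮ

/-- The action `V ⊗ V̄` on `N ⊗ N̄`. -/
def pairAction (N : ℕ) (V : Matrix (Fin N) (Fin N) ℂ) (T : PairSpace N) : PairSpace N :=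
  WithLp.toLp 2 fun p => ∑ q : Fin N × Fin N, V p.1 q.1 * star (V p.2 q.2) * T q

/-- The kernel `⟨s| (1 - |singlet⟩⟨singlet|) |t⟩` of the projection onto the adjoint irrep. -/
def adjointProj (N : ℕ) (s t : Fin N × Fin N) : ℂ :=
  (if s = t then 1 else 0) - singlet N s * star (singlet N t)

/-! ### The valence bond state on an open chain -/

/-- The valence bonds on `n` sites: the `N̄` spin of each site forms a singlet with the `N` spin of
the next one; the `N` spin of the first site is in the edge state `ψ`, and the `N̄` spin of the last
site forms a singlet with one free `N` spin, whose index is `e`. -/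
def bondState (N n : ℕ) (ψ : Fin N → ℂ) (t : Fin n → Fin N × Fin N) (e : Fin N) : ℂ :=
  let left : Fin (n + 1) → Fin N := Fin.snoc (fun k => (t k).1) e
  ψ (left 0) * ∏ k : Fin n, singlet N (left k.succ, (t k).2)

/-- The `SU(N)` AKLT state with edge state `ψ`: the valence bonds, projected onto the adjoint irrep
at each of the `n` sites, and normalized. The `N` spin with index `e` at the open end is the virtual
system. -/
def akltState (N n : ℕ) (ψ : Fin N → ℂ) (s : Fin n → Fin N × Fin N) (e : Fin N) : ℂ :=
  ((N / Real.sqrt ((N : ℝ) ^ 2 - 1) : ℝ) : ℂ) ^ n *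
    ∑ t : Fin n → Fin N × Fin N, (∏ k, adjointProj N (s k) (t k)) * bondState N n ψ t e

/-! ### Adaptive on-site projective measurements -/

/-- A complete on-site projective measurement: an orthonormal basis of the on-site space. -/
abbrev SiteBasis (N : ℕ) : Type := OrthonormalBasis (Label N) ℂ (adjointSpace N)

/-- The virtual state (not normalized) after the outcomes `o` on all `n` sites, where each site is
measured in a basis `B h` that may depend on the list `h` of the earlier outcomes. -/
def postState (N n : ℕ) (B : List (Label N) → SiteBasis N) (ψ : Fin N → ℂ)
    (o : Fin n → Label N) : Fin N → ℂ := fun e =>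
  ∑ s : Fin n → Fin N × Fin N,
    (∏ k : Fin n, star ((B ((List.ofFn o).take k.val) (o k) : PairSpace N) (s k))) *
      akltState N n ψ s e

/-- The Born probability of the outcomes `o`. -/
def prob (N n : ℕ) (B : List (Label N) → SiteBasis N) (ψ : Fin N → ℂ)
    (o : Fin n → Label N) : ℝ :=
  ∑ e, ‖postState N n B ψ o e‖ ^ 2

/-- The Kraus operator on the virtual space that belongs to a vector of the on-site space. -/
def kraus (N : ℕ) (T : PairSpace N) : Matrix (Fin N) (Fin N) ℂ :=
  ((Real.sqrt (N / ((N : ℝ) ^ 2 - 1)) : ℝ) : ℂ) • (toMat N T)ᴴ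

/-- The product of the Kraus operators of the outcomes `o`, that of the first site acting first. -/
def virtualOp (N n : ℕ) (B : List (Label N) → SiteBasis N) (o : Fin n → Label N) :
    Matrix (Fin N) (Fin N) ℂ :=
  (List.ofFn fun k : Fin n => kraus N (B ((List.ofFn o).take k.val) (o k))).reverse.prod

/-! ### Rotated bases and gates -/

/-- The on-site vector whose Kraus operator is proportional to `X ^ i Z ^ j`. -/
def hwVector (N : ℕ) (α : Label N) : PairSpace N :=
  toPair N (((1 / Real.sqrt N : ℝ) : ℂ) • (hw N α.1)ᴴ)

/-- `B` is the Heisenberg–Weyl basis rotated by the on-site symmetry action of `V†`. -/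
def IsRotatedBy (N : ℕ) (V : Matrix (Fin N) (Fin N) ℂ) (B : SiteBasis N) : Prop :=
  ∀ α, (B α : PairSpace N) = pairAction N Vᴴ (hwVector N α)

/-- The operators `Z, X, XZ, X²Z, …, X^(N-1)Z`. -/
def axisOperators (N : ℕ) : Set (Matrix (Fin N) (Fin N) ℂ) :=
  {O | O = shiftX N ∨ ∃ j : Fin N, O = shiftX N ^ j.val * clockZ N}

/-- `V = exp (iθ |v⟩⟨v|)` for a unit eigenvector `v` of one of the operators above. -/
def IsElementaryGate (N : ℕ) (V : Matrix (Fin N) (Fin N) ℂ) : Prop :=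
  ∃ O ∈ axisOperators N, ∃ (v : Fin N → ℂ) (μ : ℂ) (θ : ℝ),
    ∑ e, ‖v e‖ ^ 2 = 1 ∧ O *ᵥ v = μ • v ∧
      V = NormedSpace.exp ((Complex.I * θ) • Matrix.vecMulVec v (star v))

/-- An adaptive scheme: after the earlier outcomes `h`, the next site is measured in the basis
rotated by the elementary gate `gate h`. -/
structure GateProtocol (N : ℕ) where
  gate : List (Label N) → Matrix (Fin N) (Fin N) ℂ
  basis : List (Label N) → SiteBasis N
  elementary : ∀ h, IsElementaryGate N (gate h)
  rotated : ∀ h, IsRotatedBy N (gate h) (basis h)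

/-- The gate that remains when the byproduct `W = X ^ i Z ^ j` is pulled out of `V† W V` to the
left: `V† W V = W (W† V† W V)`. -/
def inducedGate (N : ℕ) (V : Matrix (Fin N) (Fin N) ℂ) (α : Label N) :
    Matrix (Fin N) (Fin N) ℂ :=
  (hw N α.1)ᴴ * Vᴴ * hw N α.1 * V

end AKLT

end

open scoped Matrix

noncomputable section

namespace AKLT

/-! The chain is a matrix product state. Each site acts on the virtual space by `siteOp`, and
contracting it with the conjugate of a traceless on-site vector kills the singlet part of the
projector and leaves the Kraus operator (`sum_star_mul_siteOp`). Normalization and the product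
formula follow by induction on the number of sites. In a rotated Heisenberg–Weyl basis every Kraus
operator is a unitary divided by `√(N² - 1)`, so outcomes are uniform whatever the state is, and
every probability becomes a count of labels.

An elementary gate is a complex reflection `refl v z` along an eigenvector `v` of an axis operator
`O`. Its induced gate is the product of the reflections along `W†v` and `v` with conjugate phases.
If `W` commutes with `O`, then `W` is proportional to a power of `O`, so `W†v` is parallel to `v`
and the two reflections cancel. Otherwise `W†v` is an eigenvector of `O` for another eigenvalue,
hence orthogonal to `v`, and the gate is nontrivial unless `z = 1`. Exactly `N` of the `N²`
operators `X ^ i Z ^ j`, the identity among them, commute with `O`; this leaves `N² - N` nontrivial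
outcomes among `N² - 1`.

For universality, conjugation by byproducts preserves elementary gates, so adaptivity can undo
earlier byproducts (`correctedProtocol_virtualOp`), and only products of induced gates matter. In
the eigenbasis of an axis, a diagonal target with phase `z` at `k` and `z̄` at `l` keeps this form
after a measurement, with `k` moved at random; the target is reached when the walk hits `l`
(`IsAxisFrame.performs_pair`). With an `N`-th root of the phase, this yields all reflections along
computational and Fourier basis vectors, up to scalars and with arbitrarily small failure
probability.

What remains is algebra. In a monoid of matrices, the directions along which all reflections belong
to the monoid are closed under combining two non-orthogonal ones (`Reflects.plane`,
`Reflects.add_smul`). The coordinate vectors and `(1, …, 1)` therefore give every direction, and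
reflections generate the unitary group (`unitary_mem_of_reflects`). -/

/-! ### Complex reflections -/

section Reflections

variable {n : Type*} [Fintype n] [DecidableEq n]

/-- The complex reflection that multiplies `w` by `z` and fixes the orthogonal complement of `w`. -/
def refl (w : n → ℂ) (z : ℂ) : Matrix n n ℂ :=
  1 + ((z - 1) / (star w ⬝ᵥ w)) • Matrix.vecMulVec w (star w)

lemma refl_mulVec (w : n → ℂ) (z : ℂ) (v : n → ℂ) :
    refl w z *ᵥ v = v + ((z - 1) * (star w ⬝ᵥ v) / (star w ⬝ᵥ w)) • w := by
  ext i
  simp [refl, Matrix.add_mulVec, Matrix.smul_mulVec, Matrix.vecMulVec_mulVec]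
  ring

omit [DecidableEq n] in
lemma dotProduct_self_ne_zero {w : n → ℂ} (hw : w ≠ 0) : star w ⬝ᵥ w ≠ 0 := by
  open scoped ComplexOrder in
  simpa using hw

lemma refl_of_unit {w : n → ℂ} (hw : star w ⬝ᵥ w = 1) (z : ℂ) :
    refl w z = 1 + (z - 1) • Matrix.vecMulVec w (star w) := by
  simp [refl, hw]

@[simp] lemma refl_one (w : n → ℂ) : refl w 1 = 1 := by simp [refl]

lemma refl_mul {w : n → ℂ} (hw : w ≠ 0) (z z' : ℂ) :
    refl w z * refl w z' = refl w (z * z') := by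
  have h := dotProduct_self_ne_zero hw
  simp only [refl, add_mul, mul_add, one_mul, mul_one, smul_mul_assoc, mul_smul_comm,
    Matrix.vecMulVec_mul_vecMulVec, Matrix.vecMulVec_smul, smul_add, smul_smul]
  rw [add_assoc, ← add_assoc (_ • _), ← add_smul, ← add_smul]
  congr 2
  field_simp
  ring

omit [DecidableEq n] in
lemma star_dotProduct_comm (v w : n → ℂ) : star (star v ⬝ᵥ w) = star w ⬝ᵥ v := by
  rw [Matrix.star_dotProduct, star_star]

lemma refl_conjTranspose (w : n → ℂ) (z : ℂ) : (refl w z)ᴴ = refl w (star z) := by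
  simp [refl, Matrix.conjTranspose_add, Matrix.conjTranspose_smul, Matrix.conjTranspose_vecMulVec,
    star_dotProduct_comm]

lemma refl_smul {c : ℂ} (hc : c ≠ 0) (w : n → ℂ) (z : ℂ) : refl (c • w) z = refl w z := by
  have hc' : star c ≠ 0 := star_ne_zero.2 hc
  simp only [refl, star_smul, smul_dotProduct, dotProduct_smul, Matrix.smul_vecMulVec,
    Matrix.vecMulVec_smul, smul_smul, smul_eq_mul]
  congr 2
  by_cases h : star w ⬝ᵥ w = 0
  · simp [h]
  · field_simp

lemma refl_mem_unitaryGroup {w : n → ℂ} (hw : w ≠ 0) {z : ℂ} (hz : ‖z‖ = 1) :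
    refl w z ∈ Matrix.unitaryGroup n ℂ := by
  rw [Matrix.mem_unitaryGroup_iff, Matrix.star_eq_conjTranspose, refl_conjTranspose, refl_mul hw]
  have : z * star z = 1 := by
    rw [Complex.star_def, Complex.mul_conj, Complex.normSq_eq_norm_sq, hz]; simp
  rw [this, refl_one]

lemma dotProduct_mulVec_unitary {U : Matrix n n ℂ} (hU : U ∈ Matrix.unitaryGroup n ℂ)
    (v w : n → ℂ) : star (U *ᵥ v) ⬝ᵥ (U *ᵥ w) = star v ⬝ᵥ w := by
  rw [Matrix.mem_unitaryGroup_iff', Matrix.star_eq_conjTranspose] at hU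
  rw [Matrix.star_mulVec, ← Matrix.dotProduct_mulVec, Matrix.mulVec_mulVec, hU, Matrix.one_mulVec]

lemma conj_refl {U : Matrix n n ℂ} (hU : U ∈ Matrix.unitaryGroup n ℂ) (w : n → ℂ) (z : ℂ) :
    U * refl w z * Uᴴ = refl (U *ᵥ w) z := by
  have h := Matrix.mem_unitaryGroup_iff.1 hU
  rw [Matrix.star_eq_conjTranspose] at h
  rw [refl, refl, dotProduct_mulVec_unitary hU]
  simp only [mul_add, add_mul, mul_one, h, mul_smul_comm,
    smul_mul_assoc, Matrix.mul_vecMulVec, Matrix.vecMulVec_mul, Matrix.star_mulVec]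

omit [DecidableEq n] in
lemma dotProduct_self_eq_sum (v : n → ℂ) :
    star v ⬝ᵥ v = ((∑ i, ‖v i‖ ^ 2 : ℝ) : ℂ) := by
  simp only [dotProduct, Pi.star_apply, Complex.star_def, Complex.conj_mul']
  push_cast; rfl

omit [DecidableEq n] in
lemma exists_smul_unit {w : n → ℂ} (hw : w ≠ 0) :
    ∃ c : ℂ, c ≠ 0 ∧ star (c • w) ⬝ᵥ (c • w) = 1 := by
  have hpos : 0 < ∑ i, ‖w i‖ ^ 2 := by
    obtain ⟨i, hi⟩ := Function.ne_iff.1 hw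
    refine Finset.sum_pos' (fun _ _ => by positivity) ⟨i, Finset.mem_univ _, ?_⟩
    have : w i ≠ 0 := hi
    positivity
  refine ⟨((Real.sqrt (∑ i, ‖w i‖ ^ 2))⁻¹ : ℝ), ?_, ?_⟩
  · exact_mod_cast (inv_pos.2 (Real.sqrt_pos.2 hpos)).ne'
  · rw [star_smul, smul_dotProduct, dotProduct_smul, dotProduct_self_eq_sum]
    simp only [Complex.star_def, Complex.conj_ofReal, smul_eq_mul]
    norm_cast
    have := Real.sq_sqrt hpos.le
    have h0 := (Real.sqrt_pos.2 hpos).ne'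
    field_simp
    linarith

/-! ### Generating the unitary group by reflections -/

/-- All reflections along the direction `w` belong to `H`. -/
def Reflects (H : Submonoid (Matrix n n ℂ)) (w : n → ℂ) : Prop :=
  w ≠ 0 ∧ ∀ z : ℂ, ‖z‖ = 1 → refl w z ∈ H

variable {H : Submonoid (Matrix n n ℂ)}

lemma Reflects.smul {w : n → ℂ} (h : Reflects H w) {c : ℂ} (hc : c ≠ 0) : Reflects H (c • w) :=
  ⟨smul_ne_zero hc h.1, fun z hz => by rw [refl_smul hc]; exact h.2 z hz⟩

lemma Reflects.of_smul {w : n → ℂ} {c : ℂ} (hc : c ≠ 0) (h : Reflects H (c • w)) :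
    Reflects H w := by
  simpa [smul_smul, hc] using h.smul (inv_ne_zero hc)

/-- Conjugating a reflection along `w` by one along `w'` gives the reflection along the image of
`w`. The inverse needed for the conjugation is in `H` although `H` is only a monoid, because it is
the reflection along `w'` with the conjugate phase. -/
lemma Reflects.refl_mulVec {w w' : n → ℂ} (h : Reflects H w) (h' : Reflects H w') {z : ℂ}
    (hz : ‖z‖ = 1) : Reflects H (refl w' z *ᵥ w) := by
  have hU := refl_mem_unitaryGroup h'.1 hz
  refine ⟨fun h0 => ?_, fun z' hz' => ?_⟩
  · have := dotProduct_mulVec_unitary hU w w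
    rw [h0] at this
    exact dotProduct_self_ne_zero h.1 (by simpa using this.symm)
  · rw [← conj_refl hU, refl_conjTranspose]
    exact mul_mem (mul_mem (h'.2 _ hz) (h.2 _ hz')) (h'.2 _ (by simpa using hz))

lemma exists_phase {a b : ℂ} (h : ‖a‖ = ‖b‖) : ∃ z : ℂ, ‖z‖ = 1 ∧ b = z * a := by
  by_cases ha : a = 0
  · refine ⟨1, by simp, ?_⟩
    subst ha; simpa [eq_comm] using h
  · refine ⟨b / a, ?_, by field_simp⟩
    rw [norm_div, ← h, div_self (norm_ne_zero_iff.2 ha)]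

/-! ### Directions in the plane of two orthonormal vectors -/

section Plane

variable {u p : n → ℂ}

/-- In the plane spanned by the orthonormal vectors `u` and `p`, all directions at the same angle
to `u` are reflected if one of them is. -/
lemma Reflects.of_norm_eq (hu : star u ⬝ᵥ u = 1) (hup : star u ⬝ᵥ p = 0)
    (hKu : Reflects H u) {a b a' b' : ℂ} (h : Reflects H (a • u + b • p))
    (ha : ‖a‖ = ‖a'‖) (hb : ‖b‖ = ‖b'‖) : Reflects H (a' • u + b' • p) := by
  obtain ⟨ζ, hζ, rfl⟩ := exists_phase ha
  obtain ⟨η, hη, rfl⟩ := exists_phase hb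
  have hη0 : η ≠ 0 := by rintro rfl; simp at hη
  -- The phase `ζ / η` on the `u` component followed by the overall scalar `η`, which does not
  -- change the direction, produces both phases.
  have key := (h.refl_mulVec hKu (z := ζ / η) (by rw [norm_div, hζ, hη, div_one])).smul hη0
  convert key using 1
  rw [AKLT.refl_mulVec, hu, dotProduct_add, dotProduct_smul, dotProduct_smul, hu, hup]
  simp only [smul_add, smul_smul, smul_eq_mul, mul_one, mul_zero, add_zero, div_one]
  rw [add_right_comm, ← add_smul]
  congr 2
  field_simp
  ring

/-- Reflect `u` along a vector of weight `x` on `u`. The image has `u` component `1 + (z - 1) x`,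
whose squared modulus sweeps the interval from `(1 - 2x)²` (at `z = -1`) to `1` (at `z = 1`) as `z`
runs over the circle. Phases are then free by `Reflects.of_norm_eq`. -/
lemma Reflects.step (hu : star u ⬝ᵥ u = 1) (hp : star p ⬝ᵥ p = 1) (hup : star u ⬝ᵥ p = 0)
    (hKu : Reflects H u) {x y : ℝ} (hx0 : 0 ≤ x) (hx1 : x ≤ 1)
    (hx : ∀ a b : ℂ, ‖a‖ ^ 2 = x → ‖b‖ ^ 2 = 1 - x → Reflects H (a • u + b • p))
    (hy0 : (1 - 2 * x) ^ 2 ≤ y) (hy1 : y ≤ 1) :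
    ∀ a b : ℂ, ‖a‖ ^ 2 = y → ‖b‖ ^ 2 = 1 - y → Reflects H (a • u + b • p) := by
  intro a' b' ha' hb'
  obtain ⟨z, hz, hzy⟩ : ∃ z : ℂ, ‖z‖ = 1 ∧ ‖1 + (z - 1) * x‖ ^ 2 = y := by
    have norm_eq : ∀ z : ℂ, ‖z‖ = 1 →
        ‖1 + (z - 1) * x‖ ^ 2 = (1 - x) ^ 2 + x ^ 2 + 2 * x * (1 - x) * z.re := by
      intro z hz
      have hz2 : z.re * z.re + z.im * z.im = 1 := by
        rw [← Complex.normSq_apply, Complex.normSq_eq_norm_sq, hz, one_pow]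
      rw [← Complex.normSq_eq_norm_sq, Complex.normSq_apply]
      simp
      linear_combination x ^ 2 * hz2
    by_cases hxx : x * (1 - x) = 0
    · refine ⟨1, by simp, ?_⟩
      have : (1 - 2 * x) ^ 2 = 1 := by linear_combination -4 * hxx
      simp; linarith
    · have hpos : 0 < x * (1 - x) :=
        lt_of_le_of_ne (mul_nonneg hx0 (by linarith)) (Ne.symm hxx)
      -- The real part of `z` found by solving `norm_eq` for it; the bounds on `y` say exactly that
      -- it lies in `[-1, 1]`.
      set r : ℝ := (y - (1 - x) ^ 2 - x ^ 2) / (2 * (x * (1 - x))) with hr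
      have hr1 : r ≤ 1 := by
        rw [hr, div_le_one (by positivity)]; nlinarith
      have hr2 : -1 ≤ r := by
        rw [hr, le_div_iff₀ (by positivity)]; nlinarith
      have hs : 0 ≤ 1 - r ^ 2 := by nlinarith
      have hz : ‖(⟨r, Real.sqrt (1 - r ^ 2)⟩ : ℂ)‖ = 1 := by
        have : ‖(⟨r, Real.sqrt (1 - r ^ 2)⟩ : ℂ)‖ ^ 2 = 1 := by
          rw [← Complex.normSq_eq_norm_sq, Complex.normSq_mk, Real.mul_self_sqrt hs]; ring
        exact (pow_eq_one_iff_of_nonneg (norm_nonneg _) two_ne_zero).1 this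
      refine ⟨_, hz, ?_⟩
      rw [norm_eq _ hz, hr]
      have h1 : (1 - x) ≠ 0 := right_ne_zero_of_mul hxx
      have h2 : x ≠ 0 := left_ne_zero_of_mul hxx
      field_simp
      ring
  have hw := hx (Real.sqrt x : ℂ) (Real.sqrt (1 - x) : ℂ)
    (by rw [Complex.norm_real, Real.norm_eq_abs, sq_abs, Real.sq_sqrt hx0])
    (by rw [Complex.norm_real, Real.norm_eq_abs, sq_abs, Real.sq_sqrt (by linarith)])
  have key := hKu.refl_mulVec hw hz
  have hpu : star p ⬝ᵥ u = 0 := by rw [← star_dotProduct_comm, hup, star_zero]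
  have e1 : (Real.sqrt x : ℂ) * Real.sqrt x = x := by exact_mod_cast Real.mul_self_sqrt hx0
  have e2 : (Real.sqrt (1 - x) : ℂ) * Real.sqrt (1 - x) = 1 - x := by
    exact_mod_cast Real.mul_self_sqrt (by linarith : 0 ≤ 1 - x)
  have hform : refl ((Real.sqrt x : ℂ) • u + (Real.sqrt (1 - x) : ℂ) • p) z *ᵥ u =
      (1 + (z - 1) * x) • u + ((z - 1) * Real.sqrt x * Real.sqrt (1 - x)) • p := by
    rw [AKLT.refl_mulVec]
    simp only [star_add, star_smul, add_dotProduct, smul_dotProduct, dotProduct_add,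
      dotProduct_smul, hu, hp, hup, hpu, Complex.star_def, Complex.conj_ofReal, smul_eq_mul,
      mul_one, mul_zero, add_zero, zero_add, e1, e2]
    rw [add_sub_cancel, div_one, smul_add, smul_smul, smul_smul, ← add_assoc, mul_assoc, e1,
      add_smul, one_smul]
  rw [hform] at key
  refine Reflects.of_norm_eq hu hup hKu key ?_ ?_
  · rw [← sq_eq_sq₀ (norm_nonneg _) (norm_nonneg _), hzy, ha']
  · rw [← sq_eq_sq₀ (norm_nonneg _) (norm_nonneg _), hb', norm_mul, norm_mul, Complex.norm_real,
      Complex.norm_real, mul_pow, mul_pow, Real.norm_eq_abs, Real.norm_eq_abs, sq_abs, sq_abs,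
      Real.sq_sqrt hx0, Real.sq_sqrt (by linarith), ← hzy]
    have hz2 : z.re * z.re + z.im * z.im = 1 := by
      rw [← Complex.normSq_apply, Complex.normSq_eq_norm_sq, hz, one_pow]
    rw [← Complex.normSq_eq_norm_sq, ← Complex.normSq_eq_norm_sq, Complex.normSq_apply,
      Complex.normSq_apply]
    simp
    linear_combination x * hz2

/-- In the plane spanned by the orthonormal vectors `u` and `p`, all directions are reflected if
`u` is and some direction neither parallel nor orthogonal to `u` is. -/
lemma Reflects.plane (hu : star u ⬝ᵥ u = 1) (hp : star p ⬝ᵥ p = 1) (hup : star u ⬝ᵥ p = 0)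
    (hKu : Reflects H u) {a b : ℂ} (ha : a ≠ 0) (hb : b ≠ 0)
    (hab : ‖a‖ ^ 2 + ‖b‖ ^ 2 = 1) (h : Reflects H (a • u + b • p)) {a' b' : ℂ}
    (hab' : ‖a'‖ ^ 2 + ‖b'‖ ^ 2 = 1) : Reflects H (a' • u + b' • p) := by
  set Q : ℝ → Prop := fun x =>
    ∀ a b : ℂ, ‖a‖ ^ 2 = x → ‖b‖ ^ 2 = 1 - x → Reflects H (a • u + b • p) with hQ
  have step : ∀ {x y : ℝ}, 0 ≤ x → x ≤ 1 → Q x → (1 - 2 * x) ^ 2 ≤ y → y ≤ 1 → Q y :=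
    fun hx0 hx1 hx hy0 hy1 => Reflects.step hu hp hup hKu hx0 hx1 hx hy0 hy1
  have ha2 : 0 < ‖a‖ ^ 2 := by positivity
  have hb2 : 0 < ‖b‖ ^ 2 := by positivity
  have h0 : Q (‖a‖ ^ 2) := fun c d hc hd => Reflects.of_norm_eq hu hup hKu h
    (by rw [← sq_eq_sq₀ (norm_nonneg _) (norm_nonneg _), hc])
    (by rw [← sq_eq_sq₀ (norm_nonneg _) (norm_nonneg _), hd]; linarith)
  set y₀ : ℝ := (1 - 2 * ‖a‖ ^ 2) ^ 2 with hy₀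
  have hy₀1 : y₀ < 1 := by rw [hy₀]; nlinarith
  -- All weights in `[y, 1]` are available. As long as `y > 1/2`, replacing `y` by `(1 - 2y)²` turns
  -- `1 - y` into `4y(1 - y)`, more than its double, so `y ≤ 1/2` is reached after finitely many
  -- steps.
  have doubling : ∀ k : ℕ, ∃ y : ℝ, 0 ≤ y ∧ y < 1 ∧ min (1 / 2) (2 ^ k * (1 - y₀)) ≤ 1 - y ∧
      ∀ y', y ≤ y' → y' ≤ 1 → Q y' := by
    intro k
    induction k with
    | zero =>
      refine ⟨y₀, sq_nonneg _, hy₀1, by simp, fun y' h1 h2 => ?_⟩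
      exact step ha2.le (by linarith) h0 h1 h2
    | succ k ih =>
      obtain ⟨y, hy0, hy1, hle, hall⟩ := ih
      by_cases hy : y ≤ 1 / 2
      · exact ⟨y, hy0, hy1, (min_le_left _ _).trans (by linarith), hall⟩
      · push Not at hy
        refine ⟨(1 - 2 * y) ^ 2, sq_nonneg _, by nlinarith, ?_, fun y' h1 h2 => ?_⟩
        · have hlt : 2 ^ k * (1 - y₀) ≤ 1 - y := by
            rcases min_le_iff.1 hle with h | h
            · linarith
            · exact h
          refine (min_le_right _ _).trans ?_
          rw [pow_succ]
          nlinarith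
        · exact step hy0 hy1.le (hall y le_rfl hy1.le) h1 h2
  have half : Q (1 / 2) := by
    obtain ⟨k, hk⟩ := pow_unbounded_of_one_lt (1 / (1 - y₀)) (one_lt_two (α := ℝ))
    obtain ⟨y, -, -, hle, hall⟩ := doubling k
    have : 1 ≤ 2 ^ k * (1 - y₀) := by
      rw [div_lt_iff₀ (by linarith)] at hk; exact hk.le
    rw [min_eq_left (by linarith)] at hle
    exact hall _ (by linarith) (by norm_num)
  have hb' := sq_nonneg ‖b'‖
  -- From weight `1/2` every weight is reached, since `(1 - 2 · 1/2)² = 0`.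
  exact step (by norm_num) (by norm_num) half (by norm_num) (by linarith) a' b' rfl (by linarith)

end Plane

/-- The directions that are reflected are closed under linear combinations of two non-orthogonal
ones. -/
lemma Reflects.add_smul {u w : n → ℂ} (hu : Reflects H u) (hw : Reflects H w)
    (huw : star u ⬝ᵥ w ≠ 0) (t : ℂ) (h0 : w + t • u ≠ 0) : Reflects H (w + t • u) := by
  obtain ⟨c, hc, hcu⟩ := exists_smul_unit hu.1
  obtain ⟨u', hu'⟩ : ∃ u', u' = c • u := ⟨_, rfl⟩
  rw [← hu'] at hcu
  have hKu' : Reflects H u' := hu' ▸ hu.smul hc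
  have hudef : u = c⁻¹ • u' := by rw [hu', smul_smul, inv_mul_cancel₀ hc, one_smul]
  -- The part of `w` orthogonal to `u'`. Both `w` and `w + t • u` have it as their orthogonal part,
  -- so unless it vanishes they span directions of the same plane, and `w` is neither parallel nor
  -- orthogonal to `u'`.
  obtain ⟨q, hq⟩ : ∃ q, q = w - (star u' ⬝ᵥ w) • u' := ⟨_, rfl⟩
  have hqu : star u' ⬝ᵥ q = 0 := by
    rw [hq, dotProduct_sub, dotProduct_smul, hcu]; simp
  have hwq : w = (star u' ⬝ᵥ w) • u' + q := by rw [hq]; abel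
  by_cases hq0 : q = 0
  · have hwu : w + t • u = (star u' ⬝ᵥ w + t * c⁻¹) • u' := by
      rw [hudef, smul_smul, _root_.add_smul]
      conv_lhs => rw [hwq, hq0, add_zero]
    rw [hwu] at h0 ⊢
    exact hKu'.smul (left_ne_zero_of_smul h0)
  obtain ⟨d, hd, hdq⟩ := exists_smul_unit hq0
  obtain ⟨p, hp⟩ : ∃ p, p = d • q := ⟨_, rfl⟩
  rw [← hp] at hdq
  have hqp : q = d⁻¹ • p := by rw [hp, smul_smul, inv_mul_cancel₀ hd, one_smul]
  have hup : star u' ⬝ᵥ p = 0 := by rw [hp, dotProduct_smul, hqu, smul_zero]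
  have hpu : star p ⬝ᵥ u' = 0 := by rw [← star_dotProduct_comm, hup, star_zero]
  have hnorm : ∀ a b : ℂ, star (a • u' + b • p) ⬝ᵥ (a • u' + b • p) = 1 →
      ‖a‖ ^ 2 + ‖b‖ ^ 2 = 1 := by
    intro a b hab
    simp only [star_add, star_smul, add_dotProduct, smul_dotProduct, dotProduct_add,
      dotProduct_smul, hcu, hdq, hup, hpu, smul_eq_mul, mul_one, mul_zero, add_zero, zero_add,
      Complex.star_def, Complex.mul_conj'] at hab
    exact_mod_cast hab
  have ha0 : star u' ⬝ᵥ w ≠ 0 := by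
    rw [hu', star_smul, smul_dotProduct]
    exact smul_ne_zero (star_ne_zero.2 hc) huw
  generalize star u' ⬝ᵥ w = a at ha0 hwq
  have hw2 : w = a • u' + d⁻¹ • p := by rw [← hqp]; exact hwq
  have hw'2 : w + t • u = (a + t * c⁻¹) • u' + d⁻¹ • p := by
    rw [hudef, smul_smul, _root_.add_smul]
    conv_lhs => rw [hw2]
    abel
  obtain ⟨e, he, hew⟩ := exists_smul_unit hw.1
  obtain ⟨f, hf, hfw⟩ := exists_smul_unit h0
  have hKw := hw.smul he
  rw [hw2, smul_add, smul_smul, smul_smul] at hew hKw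
  refine Reflects.of_smul hf ?_
  rw [hw'2, smul_add, smul_smul, smul_smul] at hfw ⊢
  exact Reflects.plane hcu hdq hup hKu' (mul_ne_zero he ha0) (mul_ne_zero he (inv_ne_zero hd))
    (hnorm _ _ hew) hKw (hnorm _ _ hfw)

/-- If the coordinate directions and the direction `(1, …, 1)` are reflected, then every direction
is. -/
lemma Reflects.of_single_of_one (hs : ∀ i, Reflects H (Pi.single i 1)) (h1 : Reflects H (1 : n → ℂ))
    {t : n → ℂ} (ht : t ≠ 0) : Reflects H t := by
  have main : ∀ s : Finset n, Reflects H (fun i => if i ∈ s then t i else 1) := by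
    intro s
    induction s using Finset.induction_on with
    | empty => simpa [Pi.one_def] using h1
    | insert i s hi ih =>
      have hform : (fun j => if j ∈ insert i s then t j else 1) =
          (fun j => if j ∈ s then t j else 1) + (t i - 1) • Pi.single i (1 : ℂ) := by
        ext j
        by_cases hj : j = i
        · subst hj; simp [hi]
        · simp [hj]
      rw [hform]
      -- The entries of `(1, …, 1)` are replaced one at a time. Entry `i` is still `1` at this
      -- moment, so the vector is not orthogonal to the coordinate direction.
      refine Reflects.add_smul (hs i) ih ?_ _ ?_
      · simp [hi]
      · rw [← hform]
        obtain ⟨j, hj⟩ := Function.ne_iff.1 ht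
        refine Function.ne_iff.2 ⟨j, ?_⟩
        simp only [Pi.zero_apply] at hj ⊢
        split_ifs
        · exact hj
        · exact one_ne_zero
  simpa using main Finset.univ

/-- For vectors `a ≠ b` of equal norm there is a reflection along `a - b` that maps `a` to `b`. -/
lemma exists_refl_mulVec_eq {a b : n → ℂ} (ha : star a ⬝ᵥ a = star b ⬝ᵥ b) (hab : a - b ≠ 0) :
    ∃ z : ℂ, ‖z‖ = 1 ∧ refl (a - b) z *ᵥ a = b := by
  set q := star (a - b) ⬝ᵥ a with hq
  have hqq : star (a - b) ⬝ᵥ (a - b) = q + star q := by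
    rw [hq, star_dotProduct_comm, star_sub, sub_dotProduct, sub_dotProduct, dotProduct_sub,
      dotProduct_sub]
    linear_combination -ha
  have hne := dotProduct_self_ne_zero hab
  have hq0 : q ≠ 0 := by
    intro h; rw [hqq, h] at hne; simp at hne
  -- The coefficient of `a - b` in the reflected vector must be `-1`. As `a` and `b` have equal
  -- norm, `‖a - b‖² = q + star q`, and solving gives this phase.
  refine ⟨-star q / q, ?_, ?_⟩
  · rw [norm_div, norm_neg, norm_star, div_self (norm_ne_zero_iff.2 hq0)]
  · rw [refl_mulVec, ← hq, hqq]
    have : (-star q / q - 1) * q / (q + star q) = -1 := by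
      rw [hqq] at hne
      field_simp
      ring
    rw [this]; simp

/-- A monoid of matrices that contains all reflections contains all unitary matrices. -/
lemma unitary_mem_of_reflects (h : ∀ w : n → ℂ, w ≠ 0 → Reflects H w) {U : Matrix n n ℂ}
    (hU : U ∈ Matrix.unitaryGroup n ℂ) : U ∈ H := by
  have main : ∀ s : Finset n, ∀ U ∈ Matrix.unitaryGroup n ℂ,
      (∀ i ∉ s, U *ᵥ Pi.single i 1 = Pi.single i 1) → U ∈ H := by
    intro s
    induction s using Finset.induction_on with
    | empty =>
      intro U _ hfix
      have : U = 1 := by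
        refine Matrix.ext_of_mulVec_single fun i => ?_
        rw [hfix i (by simp), Matrix.one_mulVec]
      rw [this]; exact one_mem H
    | insert i s hi ih =>
      intro U hU hfix
      by_cases h0 : U *ᵥ Pi.single i 1 - Pi.single i 1 = 0
      · refine ih U hU fun j hj => ?_
        by_cases hji : j = i
        · subst hji; exact sub_eq_zero.1 h0
        · exact hfix j (by simp [hji, hj])
      · obtain ⟨z, hz, hzU⟩ := exists_refl_mulVec_eq (dotProduct_mulVec_unitary hU _ _) h0
        set w := U *ᵥ Pi.single i 1 - Pi.single i 1 with hw
        have hmem : refl w z * U ∈ H := by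
          refine ih _ (mul_mem (refl_mem_unitaryGroup h0 hz) hU) fun j hj => ?_
          rw [← Matrix.mulVec_mulVec]
          by_cases hji : j = i
          · subst hji; exact hzU
          · have hUj := hfix j (by simp [hji, hj])
            rw [hUj, refl_mulVec]
            -- The reflection that repairs `e_i` does not disturb an `e_j` already fixed: `U`
            -- preserves inner products, so `U e_i - e_i` is orthogonal to `e_j = U e_j`.
            have : star w ⬝ᵥ Pi.single j 1 = 0 := by
              have h1 := dotProduct_mulVec_unitary hU (Pi.single i 1) (Pi.single j 1)
              rw [hUj] at h1
              rw [hw, star_sub, sub_dotProduct, h1, sub_self]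
            simp [this]
        have hz' : star z * z = 1 := by
          rw [Complex.star_def, Complex.conj_mul', hz]; simp
        have : U = refl w (star z) * (refl w z * U) := by
          rw [← mul_assoc, refl_mul h0, hz', refl_one, one_mul]
        rw [this]
        exact mul_mem ((h w h0).2 _ (by simpa using hz)) hmem
  exact main Finset.univ U hU (by simp)

end Reflections

/-! ### Algebra of the Heisenberg–Weyl operators -/

/-- The primitive root of unity `exp (2πi / N)`. -/
def rootN (N : ℕ) : ℂ := Complex.exp (2 * Real.pi * Complex.I / N)

section HeisenbergWeyl

variable (N : ℕ) [NeZero N]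

lemma isPrimitiveRoot_rootN : IsPrimitiveRoot (rootN N) N :=
  Complex.isPrimitiveRoot_exp N (NeZero.ne N)

lemma rootN_pow_self : rootN N ^ N = 1 := (isPrimitiveRoot_rootN N).pow_eq_one

lemma rootN_ne_zero : rootN N ≠ 0 := (isPrimitiveRoot_rootN N).ne_zero (NeZero.ne N)

lemma norm_rootN : ‖rootN N‖ = 1 := (isPrimitiveRoot_rootN N).norm'_eq_one (NeZero.ne N)

lemma star_rootN : star (rootN N) = (rootN N)⁻¹ := by
  rw [Complex.inv_def, Complex.normSq_eq_norm_sq, norm_rootN]; simp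

lemma rootN_pow_mod (k : ℕ) : rootN N ^ (k % N) = rootN N ^ k :=
  (pow_eq_pow_mod k (rootN_pow_self N)).symm

omit [NeZero N] in
lemma shiftX_pow_apply (i : ℕ) (a b : Fin N) :
    (shiftX N ^ i) a b = if b.val = (a.val + i) % N then 1 else 0 := by
  induction i generalizing a b with
  | zero =>
    simp only [pow_zero, Matrix.one_apply, add_zero, Nat.mod_eq_of_lt a.isLt, Fin.ext_iff]
    simp only [eq_comm]
  | succ i ih =>
    have hlt : (a.val + 1) % N < N := Nat.mod_lt _ (Nat.zero_lt_of_lt a.isLt)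
    rw [pow_succ', Matrix.mul_apply, Finset.sum_eq_single ⟨(a.val + 1) % N, hlt⟩]
    · rw [ih]
      simp [shiftX, Nat.add_comm, Nat.add_left_comm]
    · intro c _ hc
      have : c.val ≠ (a.val + 1) % N := fun h => hc (Fin.ext h)
      simp [shiftX, this]
    · simp

omit [NeZero N] in
lemma clockZ_pow (j : ℕ) :
    clockZ N ^ j = Matrix.diagonal fun l : Fin N => rootN N ^ (l.val * j) := by
  rw [clockZ, Matrix.diagonal_pow]
  congr 1
  ext l
  simp [rootN, pow_mul]

omit [NeZero N] in
lemma shiftX_mul_clockZ_apply (i j : ℕ) (a b : Fin N) :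
    (shiftX N ^ i * clockZ N ^ j) a b =
      if b.val = (a.val + i) % N then rootN N ^ (b.val * j) else 0 := by
  rw [clockZ_pow, Matrix.mul_diagonal, shiftX_pow_apply]
  split_ifs <;> simp

omit [NeZero N] in
lemma shiftX_pow_self : shiftX N ^ N = 1 := by
  ext a b
  rw [shiftX_pow_apply, Nat.add_mod_right, Nat.mod_eq_of_lt a.isLt, Matrix.one_apply]
  simp [Fin.ext_iff, eq_comm]

lemma clockZ_pow_self : clockZ N ^ N = 1 := by
  rw [clockZ_pow, ← Matrix.diagonal_one]
  congr 1
  ext l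
  rw [mul_comm, pow_mul, rootN_pow_self, one_pow]

omit [NeZero N] in
lemma shiftX_pow_mod (i : ℕ) : shiftX N ^ (i % N) = shiftX N ^ i :=
  (pow_eq_pow_mod i (shiftX_pow_self N)).symm

lemma clockZ_pow_mod (i : ℕ) : clockZ N ^ (i % N) = clockZ N ^ i :=
  (pow_eq_pow_mod i (clockZ_pow_self N)).symm

/-- The Weyl commutation relation, the source of all phases below. The shift sends `|ℓ + 1⟩` to
`|ℓ⟩`, hence the inverse root of unity. -/
lemma clockZ_mul_shiftX (i j : ℕ) :
    clockZ N ^ j * shiftX N ^ i = ((rootN N)⁻¹ ^ (j * i)) • (shiftX N ^ i * clockZ N ^ j) := by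
  ext a b
  rw [Matrix.smul_apply, shiftX_mul_clockZ_apply, clockZ_pow, Matrix.diagonal_mul, shiftX_pow_apply]
  split_ifs with h
  · rw [h, pow_mul _ ((a.val + i) % N), rootN_pow_mod, ← pow_mul, inv_pow, smul_eq_mul, mul_one]
    have := rootN_ne_zero N
    field_simp
    ring
  · simp

omit [NeZero N] in
lemma shiftX_mem_unitaryGroup : shiftX N ∈ Matrix.unitaryGroup (Fin N) ℂ := by
  rw [Matrix.mem_unitaryGroup_iff]
  ext a b
  rw [Matrix.mul_apply]
  have hlt : (a.val + 1) % N < N := Nat.mod_lt _ (Nat.zero_lt_of_lt a.isLt)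
  rw [Finset.sum_eq_single ⟨(a.val + 1) % N, hlt⟩]
  · have : (a.val + 1) % N = (b.val + 1) % N ↔ a = b := by
      constructor
      · intro h
        have h' : a.val ≡ b.val [MOD N] := Nat.ModEq.add_right_cancel' 1 h
        exact Fin.ext (Nat.ModEq.eq_of_lt_of_lt h' a.isLt b.isLt)
      · rintro rfl; rfl
    simp [shiftX, Matrix.star_apply, Matrix.one_apply, this]
  · intro c _ hc
    have : c.val ≠ (a.val + 1) % N := fun h => hc (Fin.ext h)
    simp [shiftX, this]
  · simp

lemma clockZ_mem_unitaryGroup : clockZ N ∈ Matrix.unitaryGroup (Fin N) ℂ := by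
  rw [Matrix.mem_unitaryGroup_iff, Matrix.star_eq_conjTranspose, ← pow_one (clockZ N), clockZ_pow,
    Matrix.diagonal_conjTranspose, Matrix.diagonal_mul_diagonal, ← Matrix.diagonal_one]
  congr 1
  ext l
  have := pow_ne_zero l.val (rootN_ne_zero N)
  simp [star_rootN, this]

lemma hw_mem_unitaryGroup (p : Fin N × Fin N) : hw N p ∈ Matrix.unitaryGroup (Fin N) ℂ :=
  mul_mem (pow_mem (shiftX_mem_unitaryGroup N) _) (pow_mem (clockZ_mem_unitaryGroup N) _)

lemma shiftX_clockZ_mul (i j i' j' : ℕ) :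
    shiftX N ^ i * clockZ N ^ j * (shiftX N ^ i' * clockZ N ^ j') =
      ((rootN N)⁻¹ ^ (j * i')) • (shiftX N ^ (i + i') * clockZ N ^ (j + j')) := by
  calc _ = shiftX N ^ i * (clockZ N ^ j * shiftX N ^ i') * clockZ N ^ j' := by
        simp only [mul_assoc]
    _ = _ := by
        rw [clockZ_mul_shiftX]
        simp only [mul_smul_comm, smul_mul_assoc, pow_add, mul_assoc]

lemma hw_mul (p q : Fin N × Fin N) :
    hw N p * hw N q = ((rootN N)⁻¹ ^ (p.2.val * q.1.val)) • hw N (p + q) := by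
  rw [hw, hw, hw, shiftX_clockZ_mul, Prod.fst_add, Prod.snd_add, Fin.val_add, Fin.val_add,
    shiftX_pow_mod, clockZ_pow_mod]

lemma hw_zero : hw N 0 = 1 := by simp [hw]

/-- Orthogonality of the characters of `ℤ / N`. -/
lemma sum_rootN (j k : Fin N) :
    ∑ b : Fin N, star (rootN N ^ (b.val * j.val)) * rootN N ^ (b.val * k.val) =
      if j = k then (N : ℂ) else 0 := by
  have h0 := rootN_ne_zero N
  have hterm : ∀ b : Fin N, star (rootN N ^ (b.val * j.val)) * rootN N ^ (b.val * k.val) =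
      (rootN N ^ k.val / rootN N ^ j.val) ^ b.val := by
    intro b
    rw [star_pow, star_rootN, inv_pow, div_pow, ← pow_mul, ← pow_mul, mul_comm b.val,
      mul_comm b.val]
    field_simp
  rw [Finset.sum_congr rfl fun b _ => hterm b,
    Fin.sum_univ_eq_sum_range (fun b => (rootN N ^ k.val / rootN N ^ j.val) ^ b) N]
  split_ifs with h
  · subst h
    rw [div_self (pow_ne_zero _ h0)]; simp
  · have hne : rootN N ^ k.val / rootN N ^ j.val ≠ 1 := by
      intro h1
      rw [div_eq_one_iff_eq (pow_ne_zero _ h0)] at h1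
      exact h (Fin.ext ((isPrimitiveRoot_rootN N).pow_inj k.isLt j.isLt h1).symm)
    rw [geom_sum_eq hne, div_pow, ← pow_mul, ← pow_mul, mul_comm, pow_mul, rootN_pow_self,
      mul_comm, pow_mul, rootN_pow_self]
    simp

/-- Orthogonality of the Heisenberg–Weyl operators. -/
lemma sum_star_hw_mul_hw (p q : Fin N × Fin N) :
    ∑ a, ∑ b, star (hw N p a b) * hw N q a b = if p = q then (N : ℂ) else 0 := by
  rw [Finset.sum_comm]
  by_cases h1 : p.1 = q.1
  · have hrow : ∀ b : Fin N, ∑ a, star (hw N p a b) * hw N q a b =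
        star (rootN N ^ (b.val * p.2.val)) * rootN N ^ (b.val * q.2.val) := by
      intro b
      -- Column `b` of `X ^ i Z ^ j` has a single nonzero entry, in row `b - i`.
      rw [Finset.sum_eq_single (b - p.1)]
      · have hb : b.val = ((b - p.1).val + p.1.val) % N := by
          rw [← Fin.val_add, sub_add_cancel]
        rw [hw, hw, shiftX_mul_clockZ_apply, shiftX_mul_clockZ_apply, ← h1, if_pos hb, if_pos hb]
      · intro a _ ha
        rw [hw, shiftX_mul_clockZ_apply, if_neg, star_zero, zero_mul]
        intro hb
        apply ha
        rw [eq_sub_iff_add_eq]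
        exact Fin.ext (by rw [Fin.val_add]; exact hb.symm)
      · simp
    rw [Finset.sum_congr rfl fun b _ => hrow b, sum_rootN]
    simp [Prod.ext_iff, h1]
  · have hpq : p ≠ q := fun h => h1 (by rw [h])
    rw [if_neg hpq]
    refine Finset.sum_eq_zero fun b _ => Finset.sum_eq_zero fun a _ => ?_
    rw [hw, hw, shiftX_mul_clockZ_apply, shiftX_mul_clockZ_apply]
    split_ifs with h2 h3
    · exfalso
      apply h1
      have h4 : a + p.1 = a + q.1 := by
        apply Fin.ext; rw [Fin.val_add, Fin.val_add, ← h2, ← h3]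
      exact add_left_cancel h4
    all_goals simp

end HeisenbergWeyl

/-! ### Elementary gates are reflections -/

lemma exp_smul_of_isIdempotentElem {n : Type*} [Fintype n] [DecidableEq n] {P : Matrix n n ℂ}
    (hP : IsIdempotentElem P) (t : ℂ) :
    NormedSpace.exp (t • P) = 1 + (Complex.exp t - 1) • P := by
  rw [NormedSpace.exp_eq_tsum ℂ]
  have h1 : HasSum (fun k : ℕ => ((k.factorial : ℂ)⁻¹ * t ^ k) • P) (Complex.exp t • P) := by
    refine HasSum.smul_const ?_ P
    have := NormedSpace.exp_series_hasSum_exp' (𝕂 := ℂ) t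
    rw [← Complex.exp_eq_exp_ℂ] at this
    simpa [smul_eq_mul] using this
  -- Powers of `P` equal `P` except the zeroth, which is `1`; this series corrects that one term.
  have h2 : HasSum (fun k : ℕ => if k = 0 then (1 - P) else 0) (1 - P) :=
    hasSum_ite_eq 0 (1 - P)
  have h3 := h1.add h2
  have heq : (fun k : ℕ => ((k.factorial : ℂ)⁻¹ * t ^ k) • P + if k = 0 then (1 - P) else 0) =
      fun k : ℕ => (k.factorial : ℂ)⁻¹ • (t • P) ^ k := by
    ext1 k
    rcases Nat.eq_zero_or_pos k with rfl | hk
    · simp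
    · rw [if_neg hk.ne', add_zero, smul_pow, hP.pow_eq (by omega), smul_smul]
  rw [heq] at h3
  refine (HasSum.tsum_eq h3).trans ?_
  rw [sub_smul, one_smul]
  abel

lemma exp_smul_vecMulVec {n : Type*} [Fintype n] [DecidableEq n] {v : n → ℂ}
    (hv : star v ⬝ᵥ v = 1) (t : ℂ) :
    NormedSpace.exp (t • Matrix.vecMulVec v (star v)) = refl v (Complex.exp t) := by
  rw [refl_of_unit hv, exp_smul_of_isIdempotentElem]
  rw [IsIdempotentElem, Matrix.vecMulVec_mul_vecMulVec, hv, one_smul]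

/-- Reflections ignore the length of their vector and every phase is `exp (iθ)`, so the
normalization and the exponential can be dropped. All later arguments use this form. -/
lemma isElementaryGate_iff (N : ℕ) (V : Matrix (Fin N) (Fin N) ℂ) :
    IsElementaryGate N V ↔ ∃ O ∈ axisOperators N, ∃ (v : Fin N → ℂ) (μ z : ℂ),
      v ≠ 0 ∧ ‖z‖ = 1 ∧ O *ᵥ v = μ • v ∧ V = refl v z := by
  constructor
  · rintro ⟨O, hO, v, μ, θ, hv, hOv, rfl⟩
    have hv' : star v ⬝ᵥ v = 1 := by rw [dotProduct_self_eq_sum, hv, Complex.ofReal_one]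
    refine ⟨O, hO, v, μ, Complex.exp (Complex.I * θ), ?_, ?_, hOv, exp_smul_vecMulVec hv' _⟩
    · rintro rfl; simp at hv'
    · rw [mul_comm]; exact Complex.norm_exp_ofReal_mul_I θ
  · rintro ⟨O, hO, v, μ, z, hv, hz, hOv, rfl⟩
    obtain ⟨c, hc, hcv⟩ := exists_smul_unit hv
    refine ⟨O, hO, c • v, μ, z.arg, ?_, ?_, ?_⟩
    · rw [dotProduct_self_eq_sum] at hcv; exact_mod_cast hcv
    · rw [Matrix.mulVec_smul, hOv, smul_comm]
    · rw [exp_smul_vecMulVec hcv, refl_smul hc]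
      congr 1
      conv_lhs => rw [← Complex.norm_mul_exp_arg_mul_I z, hz]
      simp [mul_comm]

/-! ### On-site bases -/

section SiteBases

variable (N : ℕ)

lemma inner_toPair (S T : Matrix (Fin N) (Fin N) ℂ) :
    inner ℂ (toPair N S) (toPair N T) = (Sᴴ * T).trace := by
  simp only [toPair, PiLp.inner_apply, RCLike.inner_apply, Matrix.trace, Matrix.diag,
    Matrix.mul_apply, Matrix.conjTranspose_apply, Fintype.sum_prod_type]
  rw [Finset.sum_comm]
  simp [mul_comm]

lemma singlet_eq_toPair : singlet N = toPair N (((1 / Real.sqrt N : ℝ) : ℂ) • 1) := by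
  ext p
  simp [singlet, toPair, Matrix.one_apply]

@[simp] lemma toMat_toPair (T : Matrix (Fin N) (Fin N) ℂ) : toMat N (toPair N T) = T := rfl

variable [NeZero N]

lemma sqrt_cast_ne_zero : ((Real.sqrt N : ℝ) : ℂ) ≠ 0 := by
  have : 0 < (N : ℝ) := by exact_mod_cast Nat.pos_of_ne_zero (NeZero.ne N)
  exact_mod_cast (Real.sqrt_pos.2 this).ne'

omit [NeZero N] in
lemma sqrt_cast_mul_self : ((Real.sqrt N : ℝ) : ℂ) * ((Real.sqrt N : ℝ) : ℂ) = N := by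
  exact_mod_cast Real.mul_self_sqrt (Nat.cast_nonneg N)

omit [NeZero N] in
lemma toPair_mem_adjointSpace {T : Matrix (Fin N) (Fin N) ℂ} (hT : T.trace = 0) :
    toPair N T ∈ adjointSpace N := by
  rw [adjointSpace, Submodule.mem_orthogonal_singleton_iff_inner_right, singlet_eq_toPair,
    inner_toPair]
  simp [hT]

lemma trace_toMat_of_mem {T : PairSpace N} (hT : T ∈ adjointSpace N) : (toMat N T).trace = 0 := by
  have h : T = toPair N (toMat N T) := rfl
  rw [adjointSpace, Submodule.mem_orthogonal_singleton_iff_inner_right, singlet_eq_toPair, h,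
    inner_toPair] at hT
  simpa [NeZero.ne N] using hT

lemma label_ne_zero (α : Label N) : α.1 ≠ 0 := fun h => α.2 (by simp [h])

lemma card_label : Fintype.card (Label N) = N ^ 2 - 1 := by
  have h : Fintype.card (Label N) = Fintype.card {p : Fin N × Fin N // ¬ p = 0} := by
    refine Fintype.card_congr (Equiv.subtypeEquivRight fun p => ?_)
    simp only [Prod.ext_iff, Fin.ext_iff, Prod.fst_zero, Prod.snd_zero, Fin.val_zero]
  rw [h, Fintype.card_subtype_compl]
  simp [sq]

lemma finrank_adjointSpace : Module.finrank ℂ (adjointSpace N) = N ^ 2 - 1 := by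
  have hs : singlet N ≠ 0 := by
    intro h
    have := congrArg (fun T : PairSpace N => T (0, 0)) h
    simp [singlet, NeZero.ne N] at this
  have h1 := Submodule.finrank_add_finrank_orthogonal (Submodule.span ℂ {singlet N})
  rw [finrank_span_singleton hs, finrank_euclideanSpace] at h1
  simp only [Fintype.card_prod, Fintype.card_fin] at h1
  rw [adjointSpace, sq]
  omega

/-- A family of traceless matrices that is orthonormal for the trace form is an on-site basis. -/
lemma exists_siteBasis (f : Label N → Matrix (Fin N) (Fin N) ℂ) (htr : ∀ α, (f α).trace = 0)
    (horth : ∀ α β, ((f α)ᴴ * f β).trace = if α = β then 1 else 0) :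
    ∃ B : SiteBasis N, ∀ α, (B α : PairSpace N) = toPair N (f α) := by
  have ho : Orthonormal ℂ
      (fun α => (⟨toPair N (f α), toPair_mem_adjointSpace N (htr α)⟩ : adjointSpace N)) := by
    rw [orthonormal_iff_ite]
    intro α β
    rw [Submodule.coe_inner, inner_toPair, horth]
  have hspan := ho.linearIndependent.span_eq_top_of_card_eq_finrank'
    (by rw [card_label, finrank_adjointSpace])
  exact ⟨OrthonormalBasis.mk ho hspan.ge, fun α => by rw [OrthonormalBasis.coe_mk]⟩

/-! ### The rotated Heisenberg–Weyl bases -/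

omit [NeZero N] in
lemma pairAction_toPair (V T : Matrix (Fin N) (Fin N) ℂ) :
    pairAction N V (toPair N T) = toPair N (V * T * Vᴴ) := by
  ext p
  simp only [pairAction, toPair, Matrix.mul_apply, Matrix.conjTranspose_apply,
    Fintype.sum_prod_type, Finset.sum_mul]
  rw [Finset.sum_comm]
  refine Finset.sum_congr rfl fun _ _ => Finset.sum_congr rfl fun _ _ => by ring

lemma trace_conjTranspose_hw_mul_hw (p q : Fin N × Fin N) :
    ((hw N p)ᴴ * hw N q).trace = if p = q then (N : ℂ) else 0 := by
  rw [← sum_star_hw_mul_hw N p q, Finset.sum_comm]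
  simp [Matrix.trace, Matrix.mul_apply]

lemma trace_hw (α : Label N) : (hw N α.1).trace = 0 := by
  have := trace_conjTranspose_hw_mul_hw N 0 α.1
  rwa [hw_zero, Matrix.conjTranspose_one, one_mul, if_neg (label_ne_zero N α).symm] at this

omit [NeZero N] in
lemma rotated_hwVector (V : Matrix (Fin N) (Fin N) ℂ) (α : Label N) :
    pairAction N Vᴴ (hwVector N α) =
      toPair N (((1 / Real.sqrt N : ℝ) : ℂ) • (Vᴴ * (hw N α.1)ᴴ * V)) := by
  rw [hwVector, pairAction_toPair, Matrix.conjTranspose_conjTranspose,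
    mul_smul_comm, smul_mul_assoc]

/-- Conjugation by a unitary preserves traces and the trace form, so tracelessness and orthogonality
of the Heisenberg–Weyl operators carry over. -/
lemma exists_rotated {V : Matrix (Fin N) (Fin N) ℂ} (hV : V ∈ Matrix.unitaryGroup (Fin N) ℂ) :
    ∃ B : SiteBasis N, IsRotatedBy N V B := by
  have hV1 := Matrix.mem_unitaryGroup_iff.1 hV
  rw [Matrix.star_eq_conjTranspose] at hV1
  suffices h : ∃ B : SiteBasis N, ∀ α, (B α : PairSpace N) =
      toPair N (((1 / Real.sqrt N : ℝ) : ℂ) • (Vᴴ * (hw N α.1)ᴴ * V)) by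
    obtain ⟨B, hB⟩ := h
    exact ⟨B, fun α => by rw [hB, rotated_hwVector]⟩
  refine exists_siteBasis N _ (fun α => ?_) (fun α β => ?_)
  · rw [Matrix.trace_smul, Matrix.trace_mul_cycle, hV1, one_mul, Matrix.trace_conjTranspose,
      trace_hw, star_zero, smul_zero]
  · have h1 : (Vᴴ * (hw N α.1)ᴴ * V)ᴴ * (Vᴴ * (hw N β.1)ᴴ * V) =
        Vᴴ * (hw N α.1 * (V * Vᴴ) * (hw N β.1)ᴴ) * V := by
      simp only [Matrix.conjTranspose_mul, Matrix.conjTranspose_conjTranspose, mul_assoc]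
    rw [Matrix.conjTranspose_smul, smul_mul_smul_comm, Matrix.trace_smul, h1, hV1,
      Matrix.trace_mul_cycle, hV1, one_mul, mul_one, Matrix.trace_mul_comm,
      trace_conjTranspose_hw_mul_hw]
    have h0 := sqrt_cast_ne_zero N
    have hs := sqrt_cast_mul_self N
    have hN : (N : ℂ) ≠ 0 := by exact_mod_cast NeZero.ne N
    by_cases h : α = β
    · subst h
      simp only [if_true, smul_eq_mul]
      push_cast
      rw [Complex.star_def, map_div₀, Complex.conj_ofReal, map_one, div_mul_div_comm, one_mul, hs]
      field_simp
    · rw [if_neg (fun h' => h (Subtype.ext h').symm), if_neg h, smul_zero]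

omit [NeZero N] in
lemma sqrt_div_sub_one (hN : 2 ≤ N) :
    Real.sqrt (N / ((N : ℝ) ^ 2 - 1)) * (1 / Real.sqrt N) = 1 / Real.sqrt ((N : ℝ) ^ 2 - 1) := by
  have h : (0 : ℝ) < N := by exact_mod_cast (by omega : 0 < N)
  have := (Real.sqrt_pos.2 h).ne'
  rw [Real.sqrt_div h.le]
  field_simp

omit [NeZero N] in
lemma kraus_of_isRotatedBy (hN : 2 ≤ N) {V : Matrix (Fin N) (Fin N) ℂ} {B : SiteBasis N}
    (hB : IsRotatedBy N V B) (α : Label N) :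
    kraus N (B α) = ((1 / Real.sqrt ((N : ℝ) ^ 2 - 1) : ℝ) : ℂ) • (Vᴴ * hw N α.1 * V) := by
  rw [hB, rotated_hwVector, kraus, toMat_toPair, ← sqrt_div_sub_one N hN]
  simp [Matrix.conjTranspose_smul, smul_smul, mul_assoc]

lemma hw_mul_inducedGate (V : Matrix (Fin N) (Fin N) ℂ) (α : Label N) :
    hw N α.1 * inducedGate N V α = Vᴴ * hw N α.1 * V := by
  have h := Matrix.mem_unitaryGroup_iff.1 (hw_mem_unitaryGroup N α.1)
  rw [Matrix.star_eq_conjTranspose] at h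
  rw [inducedGate]
  simp only [← mul_assoc, h, one_mul]

/-! ### The Gell-Mann basis -/

omit [NeZero N] in
lemma gellMann_of_lt {i j : Fin N} (h : ¬ (i.val = 0 ∧ j.val = 0)) (hij : i < j) :
    gellMann N ⟨(i, j), h⟩ = (1 / 2 : ℂ) • (Matrix.single i j 1 + Matrix.single j i 1) := by
  simp [gellMann, hij]

omit [NeZero N] in
lemma gellMann_of_gt {i j : Fin N} (h : ¬ (i.val = 0 ∧ j.val = 0)) (hij : j < i) :
    gellMann N ⟨(i, j), h⟩ = (-Complex.I / 2) • (Matrix.single j i 1 - Matrix.single i j 1) := by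
  simp [gellMann, hij, hij.le]

omit [NeZero N] in
lemma gellMann_self {i : Fin N} (h : ¬ (i.val = 0 ∧ i.val = 0)) :
    gellMann N ⟨(i, i), h⟩ = ((1 / Real.sqrt (2 * (i.val + 1) * i.val) : ℝ) : ℂ) •
      Matrix.diagonal fun l => if l < i then 1 else if l = i then -(i.val : ℂ) else 0 := by
  simp only [gellMann, lt_irrefl, if_false]
  congr 1
  ext a b
  simp only [Matrix.sub_apply, Matrix.sum_apply, Matrix.smul_apply, Matrix.single_apply,
    Matrix.diagonal_apply]
  by_cases hab : a = b
  · subst hab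
    rcases lt_trichotomy a i with hi | hi | hi
    · simp [hi, hi.ne']
    · subst hi; simp
    · simp [hi.ne, hi.ne', not_lt.2 hi.le]
  · have : ∀ l : Fin N, ¬ (l = a ∧ l = b) := fun l hl => hab (hl.1.symm.trans hl.2)
    simp [hab, this]

omit [NeZero N] in
lemma gellMann_isHermitian (β : Label N) : (gellMann N β)ᴴ = gellMann N β := by
  obtain ⟨⟨i, j⟩, h⟩ := β
  rcases lt_trichotomy i j with hij | rfl | hij
  · rw [gellMann_of_lt N h hij]
    simp [Matrix.conjTranspose_single, add_comm]
  · rw [gellMann_self, Matrix.conjTranspose_smul, Matrix.diagonal_conjTranspose]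
    congr 2
    · rw [Complex.star_def, Complex.conj_ofReal]
    · ext l
      simp only [Pi.star_apply]
      split_ifs <;> simp
  · rw [gellMann_of_gt N h hij]
    simp only [Matrix.conjTranspose_smul, Matrix.conjTranspose_sub, Matrix.conjTranspose_single,
      star_one]
    rw [← neg_sub, smul_neg, ← neg_smul]
    congr 1
    simp [neg_div]

omit [NeZero N] in
lemma sum_gellMann_diag (i : Fin N) :
    ∑ l : Fin N, (if l < i then 1 else if l = i then -(i.val : ℂ) else 0) = 0 := by
  have : ∀ l : Fin N, (if l < i then (1 : ℂ) else if l = i then -(i.val : ℂ) else 0) =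
      (if l < i then 1 else 0) + if l = i then -(i.val : ℂ) else 0 := by
    intro l
    rcases lt_trichotomy l i with h | h | h
    · simp [h, h.ne]
    · simp [h]
    · simp [h.ne', not_lt.2 h.le]
  rw [Finset.sum_congr rfl fun l _ => this l, Finset.sum_add_distrib, Finset.sum_boole,
    Finset.filter_gt_eq_Iio, Fin.card_Iio]
  simp

omit [NeZero N] in
lemma trace_gellMann (β : Label N) : (gellMann N β).trace = 0 := by
  obtain ⟨⟨i, j⟩, h⟩ := β
  rcases lt_trichotomy i j with hij | rfl | hij
  · rw [gellMann_of_lt N h hij]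
    simp [Matrix.trace_single_eq_of_ne, hij.ne, hij.ne']
  · rw [gellMann_self, Matrix.trace_smul, Matrix.trace_diagonal, sum_gellMann_diag, smul_zero]
  · rw [gellMann_of_gt N h hij]
    simp [Matrix.trace_single_eq_of_ne, hij.ne, hij.ne']

omit [NeZero N] in
-- On the support of the `i`-th diagonal the `j`-th one is constantly `1`, so the product has the
-- trace of the `i`-th.
lemma sum_gellMann_diag_mul {i j : Fin N} (hij : i < j) :
    ∑ l : Fin N, (if l < i then 1 else if l = i then -(i.val : ℂ) else 0) *
      (if l < j then 1 else if l = j then -(j.val : ℂ) else 0) = 0 := by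
  refine Eq.trans ?_ (sum_gellMann_diag N i)
  refine Finset.sum_congr rfl fun l _ => ?_
  by_cases hl : l < j
  · simp [hl]
  · have h1 : ¬ l < i := fun h => hl (h.trans hij)
    have h2 : l ≠ i := fun h => hl (h ▸ hij)
    simp [h1, h2]

omit [NeZero N] in
lemma sum_gellMann_diag_sq (i : Fin N) :
    ∑ l : Fin N, (if l < i then 1 else if l = i then -(i.val : ℂ) else 0) *
      (if l < i then 1 else if l = i then -(i.val : ℂ) else 0) = (i.val + 1) * i.val := by
  have : ∀ l : Fin N, (if l < i then 1 else if l = i then -(i.val : ℂ) else 0) *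
      (if l < i then 1 else if l = i then -(i.val : ℂ) else 0) =
      (if l < i then 1 else 0) + if l = i then (i.val : ℂ) ^ 2 else 0 := by
    intro l
    rcases lt_trichotomy l i with h | h | h
    · simp [h, h.ne]
    · simp [h, sq]
    · simp [h.ne', not_lt.2 h.le]
  rw [Finset.sum_congr rfl fun l _ => this l, Finset.sum_add_distrib, Finset.sum_boole,
    Finset.filter_gt_eq_Iio, Fin.card_Iio]
  simp
  ring

omit [NeZero N] in
lemma trace_mul_single (A : Matrix (Fin N) (Fin N) ℂ) (i j : Fin N) :
    (A * Matrix.single i j 1).trace = A j i := by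
  rw [Matrix.trace_mul_comm, Matrix.trace_single_mul, one_smul]

omit [NeZero N] in
lemma trace_gellMann_mul (β γ : Label N) :
    (gellMann N β * gellMann N γ).trace = if β = γ then 1 / 2 else 0 := by
  obtain ⟨⟨i, j⟩, h⟩ := β
  obtain ⟨⟨k, l⟩, h'⟩ := γ
  have hI := Complex.I_mul_I
  rcases lt_trichotomy k l with hkl | rfl | hkl
  · rw [gellMann_of_lt N h' hkl, mul_smul_comm, Matrix.trace_smul, mul_add, Matrix.trace_add,
      trace_mul_single, trace_mul_single]
    rcases lt_trichotomy i j with hij | rfl | hij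
    · rw [gellMann_of_lt N h hij]
      simp only [Matrix.smul_apply, Matrix.add_apply, Matrix.single_apply, smul_eq_mul,
        Subtype.mk.injEq, Prod.mk.injEq]
      split_ifs <;> first | omega | (simp; done) | norm_num
    · rw [gellMann_self]
      simp only [Matrix.smul_apply, Matrix.diagonal_apply_ne _ hkl.ne,
        Matrix.diagonal_apply_ne _ hkl.ne', Subtype.mk.injEq, Prod.mk.injEq]
      split_ifs <;> first | omega | simp
    · rw [gellMann_of_gt N h hij]
      simp only [Matrix.smul_apply, Matrix.sub_apply, Matrix.single_apply, smul_eq_mul,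
        Subtype.mk.injEq, Prod.mk.injEq]
      split_ifs <;> first | omega | simp
  · rw [gellMann_self N h']
    rcases lt_trichotomy i j with hij | rfl | hij
    · rw [gellMann_of_lt N h hij, smul_mul_assoc, add_mul, Matrix.trace_smul, Matrix.trace_add,
        Matrix.trace_single_mul, Matrix.trace_single_mul]
      simp only [Matrix.smul_apply, Matrix.diagonal_apply_ne _ hij.ne,
        Matrix.diagonal_apply_ne _ hij.ne', Subtype.mk.injEq, Prod.mk.injEq]
      split_ifs <;> first | omega | simp
    · rw [gellMann_self N h, smul_mul_smul_comm, Matrix.diagonal_mul_diagonal, Matrix.trace_smul,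
        Matrix.trace_diagonal]
      rcases lt_trichotomy i k with hik | rfl | hik
      · rw [sum_gellMann_diag_mul N hik, if_neg (by simp [hik.ne]), smul_zero]
      · rw [sum_gellMann_diag_sq, if_pos rfl]
        have hi : (0 : ℝ) < i.val := by
          have : 0 < i.val := Nat.pos_of_ne_zero fun h0 => h ⟨h0, h0⟩
          exact_mod_cast this
        have h2 := Real.mul_self_sqrt (by positivity : (0 : ℝ) ≤ 2 * (i.val + 1) * i.val)
        have h3 : 0 < Real.sqrt (2 * (i.val + 1) * i.val) := Real.sqrt_pos.2 (by positivity)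
        have : 1 / Real.sqrt (2 * (i.val + 1) * i.val) * (1 / Real.sqrt (2 * (i.val + 1) * i.val))
            * ((i.val + 1) * i.val) = 1 / 2 := by
          rw [div_mul_div_comm, h2]
          field_simp
        rw [smul_eq_mul]
        have hc := congrArg Complex.ofReal this
        push_cast at hc ⊢
        exact hc
      · rw [Finset.sum_congr rfl fun l _ => mul_comm _ _, sum_gellMann_diag_mul N hik,
          if_neg (by simp [hik.ne']), smul_zero]
    · rw [gellMann_of_gt N h hij, smul_mul_assoc, sub_mul, Matrix.trace_smul, Matrix.trace_sub,
        Matrix.trace_single_mul, Matrix.trace_single_mul]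
      simp only [Matrix.smul_apply, Matrix.diagonal_apply_ne _ hij.ne,
        Matrix.diagonal_apply_ne _ hij.ne', Subtype.mk.injEq, Prod.mk.injEq]
      split_ifs <;> first | omega | simp
  · rw [gellMann_of_gt N h' hkl, mul_smul_comm, Matrix.trace_smul, mul_sub, Matrix.trace_sub,
      trace_mul_single, trace_mul_single]
    rcases lt_trichotomy i j with hij | rfl | hij
    · rw [gellMann_of_lt N h hij]
      simp only [Matrix.smul_apply, Matrix.add_apply, Matrix.single_apply, smul_eq_mul,
        Subtype.mk.injEq, Prod.mk.injEq]
      split_ifs <;> first | omega | simp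
    · rw [gellMann_self]
      simp only [Matrix.smul_apply, Matrix.diagonal_apply_ne _ hkl.ne,
        Matrix.diagonal_apply_ne _ hkl.ne', Subtype.mk.injEq, Prod.mk.injEq]
      split_ifs <;> first | omega | simp
    · rw [gellMann_of_gt N h hij]
      simp only [Matrix.smul_apply, Matrix.sub_apply, Matrix.single_apply, smul_eq_mul,
        Subtype.mk.injEq, Prod.mk.injEq]
      split_ifs <;> first | omega | (simp; done) | (ring_nf; simp; norm_num)

lemma exists_gellMann_basis :
    ∃ M : SiteBasis N, ∀ β, (M β : PairSpace N) = toPair N ((Real.sqrt 2 : ℂ) • gellMann N β) := by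
  refine exists_siteBasis N _ (fun β => ?_) (fun β γ => ?_)
  · rw [Matrix.trace_smul, trace_gellMann, smul_zero]
  · rw [Matrix.conjTranspose_smul, gellMann_isHermitian, smul_mul_smul_comm, Matrix.trace_smul,
      trace_gellMann_mul, Complex.star_def, Complex.conj_ofReal]
    have h2 : ((Real.sqrt 2 : ℝ) : ℂ) * ((Real.sqrt 2 : ℝ) : ℂ) = 2 := by
      exact_mod_cast Real.mul_self_sqrt (by norm_num : (0 : ℝ) ≤ 2)
    rw [h2]
    split_ifs <;> simp

omit [NeZero N] in
lemma kraus_gellMann (β : Label N) :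
    kraus N (toPair N ((Real.sqrt 2 : ℂ) • gellMann N β)) =
      ((Real.sqrt (2 * N / ((N : ℝ) ^ 2 - 1)) : ℝ) : ℂ) • gellMann N β := by
  rw [kraus, toMat_toPair, Matrix.conjTranspose_smul, gellMann_isHermitian, smul_smul,
    Complex.star_def, Complex.conj_ofReal, mul_div_assoc, Real.sqrt_mul (by norm_num), mul_comm]
  push_cast
  rfl

omit [NeZero N] in
-- The Kraus operator is conjugate-linear in the vector because of the adjoint in its definition;
-- this fixes which of the two change-of-basis matrices occurs in `exists_unitary_kraus`.
lemma kraus_sum_smul {ι : Type*} (s : Finset ι) (c : ι → ℂ) (T : ι → PairSpace N) :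
    kraus N (∑ i ∈ s, c i • T i) = ∑ i ∈ s, star (c i) • kraus N (T i) := by
  ext a b
  simp [kraus, toMat, Matrix.sum_apply, Finset.mul_sum, mul_left_comm]

omit [NeZero N] in
/-- The change of basis between two on-site bases transforms their Kraus operators into each
other. -/
lemma exists_unitary_kraus (B M : SiteBasis N) :
    ∃ U ∈ Matrix.unitaryGroup (Label N) ℂ, ∀ α,
      ∑ β, U α β • kraus N (M β) = kraus N (B α) := by
  refine ⟨B.toBasis.toMatrix M, B.toMatrix_orthonormalBasis_mem_unitary M, fun α => ?_⟩
  have h : (B α : PairSpace N) = ∑ β, (inner ℂ (M β) (B α)) • (M β : PairSpace N) := by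
    conv_lhs => rw [← M.sum_repr' (B α)]
    simp
  rw [h, kraus_sum_smul]
  refine Finset.sum_congr rfl fun β _ => ?_
  congr 1
  rw [Module.Basis.toMatrix_apply, OrthonormalBasis.coe_toBasis_repr_apply,
    OrthonormalBasis.repr_apply_apply]
  exact (inner_conj_symm _ _).symm

end SiteBases

/-! ### The chain as a matrix product state -/

lemma sum_snoc {A M : Type*} [Fintype A] [AddCommMonoid M] {n : ℕ} (f : (Fin (n + 1) → A) → M) :
    ∑ t, f t = ∑ t : Fin n → A, ∑ a, f (Fin.snoc t a) := by
  rw [← (Fin.snocEquiv fun _ : Fin (n + 1) => A).sum_comp, Fintype.sum_prod_type, Finset.sum_comm]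
  rfl

lemma ofFn_snoc {A : Type*} {n : ℕ} (o : Fin n → A) (a : A) :
    List.ofFn (Fin.snoc o a : Fin (n + 1) → A) = List.ofFn o ++ [a] := by
  rw [List.ofFn_succ', List.concat_eq_append]
  simp

section Chain

variable (N : ℕ)

/-- The operator on the virtual space that belongs to the component `q` of one site. -/
def siteOp (q : Fin N × Fin N) : Matrix (Fin N) (Fin N) ℂ :=
  Matrix.of fun e l => ((N / Real.sqrt ((N : ℝ) ^ 2 - 1) : ℝ) : ℂ) *
    ∑ r, adjointProj N q (l, r) * singlet N (e, r)

lemma bondState_snoc (n : ℕ) (ψ : Fin N → ℂ) (t : Fin n → Fin N × Fin N) (p : Fin N × Fin N)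
    (e : Fin N) :
    bondState N (n + 1) ψ (Fin.snoc t p) e = bondState N n ψ t p.1 * singlet N (e, p.2) := by
  have h : (fun k => ((Fin.snoc t p : Fin (n + 1) → Fin N × Fin N) k).1) =
      (Fin.snoc (fun k => (t k).1) p.1 : Fin (n + 1) → Fin N) :=
    Fin.comp_snoc Prod.fst t p
  simp only [bondState, h]
  rw [Fin.prod_univ_castSucc, ← Fin.castSucc_zero, Fin.snoc_castSucc, Fin.succ_last,
    Fin.snoc_last, Fin.snoc_last, mul_assoc]
  simp only [← Fin.castSucc_succ, Fin.snoc_castSucc]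

/-- The matrix product form: the last projector and the last bond involve the earlier sites only
through the index `e` of their open end. -/
lemma akltState_snoc (n : ℕ) (ψ : Fin N → ℂ) (s : Fin n → Fin N × Fin N) (q : Fin N × Fin N) :
    akltState N (n + 1) ψ (Fin.snoc s q) = siteOp N q *ᵥ akltState N n ψ s := by
  ext e
  simp only [akltState, Matrix.mulVec, dotProduct, siteOp, Matrix.of_apply]
  rw [sum_snoc]
  simp only [Fin.prod_univ_castSucc, Fin.snoc_castSucc, Fin.snoc_last, bondState_snoc, pow_succ,
    Finset.mul_sum, Finset.sum_mul, Fintype.sum_prod_type]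
  rw [Finset.sum_comm]
  refine Finset.sum_congr rfl fun l _ => ?_
  refine Finset.sum_congr rfl fun t _ => ?_
  refine Finset.sum_congr rfl fun r _ => ?_
  ring

variable [NeZero N]

lemma siteOp_apply (q : Fin N × Fin N) (e l : Fin N) :
    siteOp N q e l = ((N / Real.sqrt ((N : ℝ) ^ 2 - 1) / Real.sqrt N : ℝ) : ℂ) *
      ((if q = (l, e) then 1 else 0) - if q.1 = q.2 then if l = e then (1 / N : ℂ) else 0 else 0) := by
  rw [siteOp, Matrix.of_apply, Finset.sum_eq_single e]
  · have h0 := sqrt_cast_ne_zero N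
    have hs := sqrt_cast_mul_self N
    have hN : (N : ℂ) ≠ 0 := by exact_mod_cast NeZero.ne N
    simp only [adjointProj, singlet, if_true]
    push_cast
    have hprod : (if q.1 = q.2 then (1 / ((Real.sqrt N : ℝ) : ℂ)) else 0) *
        star (if l = e then (1 / ((Real.sqrt N : ℝ) : ℂ)) else 0) =
        if q.1 = q.2 then if l = e then (1 / N : ℂ) else 0 else 0 := by
      split_ifs
      · rw [Complex.star_def, map_div₀, Complex.conj_ofReal, map_one, div_mul_div_comm, one_mul, hs]
      all_goals simp
    rw [hprod]
    ring
  · intro r _ hr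
    simp [singlet, hr.symm]
  · simp

lemma siteOp_mulVec_apply (q : Fin N × Fin N) (φ : Fin N → ℂ) (e : Fin N) :
    (siteOp N q *ᵥ φ) e = ((N / Real.sqrt ((N : ℝ) ^ 2 - 1) / Real.sqrt N : ℝ) : ℂ) *
      ((if q.2 = e then φ q.1 else 0) - if q.1 = q.2 then φ e / N else 0) := by
  simp only [Matrix.mulVec, dotProduct, siteOp_apply, mul_assoc, ← Finset.mul_sum, sub_mul,
    Finset.sum_sub_distrib]
  congr 2
  · rw [Finset.sum_eq_single q.1]
    · simp [Prod.ext_iff]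
    · intro l _ hl
      simp [Prod.ext_iff, hl.symm]
    · simp
  · split_ifs
    · simp [div_eq_mul_inv, mul_comm]
    · simp

/-- Expanding the square, the bond term contributes `N`, the singlet term `1/N` and the cross term
`-2/N`, in units of `‖φ‖²`. The total `(N² - 1)/N` is the inverse of the squared prefactor. -/
lemma sum_norm_siteOp (hN : 2 ≤ N) (φ : Fin N → ℂ) :
    ∑ q, ∑ e, ‖(siteOp N q *ᵥ φ) e‖ ^ 2 = ∑ e, ‖φ e‖ ^ 2 := by
  have hpt : ∀ a b e : Fin N,
      ‖(if b = e then φ a else 0) - if a = b then φ e / N else 0‖ ^ 2 =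
      (if b = e then ‖φ a‖ ^ 2 else 0) + (if a = b then ‖φ e‖ ^ 2 / N ^ 2 else 0) -
        if b = e then (if a = b then 2 * ‖φ a‖ ^ 2 / N else 0) else 0 := by
    intro a b e
    by_cases h1 : b = e <;> by_cases h2 : a = b
    · subst h1 h2
      simp only [if_true]
      have h : φ a - φ a / N = (((1 - 1 / N : ℝ)) : ℂ) * φ a := by push_cast; ring
      rw [h, norm_mul, mul_pow, Complex.norm_real, Real.norm_eq_abs, sq_abs]
      ring
    · subst h1; simp [h2]
    · simp [h1, h2, div_pow]
    · simp [h1, h2]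
  have hN0 : (0 : ℝ) < N := by exact_mod_cast (by omega : 0 < N)
  have hN1 : (0 : ℝ) < (N : ℝ) ^ 2 - 1 := by
    have : (2 : ℝ) ≤ N := by exact_mod_cast hN
    nlinarith
  simp only [siteOp_mulVec_apply, norm_mul, mul_pow, hpt, ← Finset.mul_sum, Fintype.sum_prod_type,
    Finset.sum_sub_distrib, Finset.sum_add_distrib, Finset.sum_ite_eq, Finset.mem_univ, if_true,
    Finset.sum_const, Finset.card_univ, Fintype.card_fin, nsmul_eq_mul]
  have hcol : ∑ a : Fin N, ∑ b : Fin N, ∑ e : Fin N, (if a = b then ‖φ e‖ ^ 2 / (N : ℝ) ^ 2 else 0) =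
      (∑ e, ‖φ e‖ ^ 2) / N := by
    have : ∀ a b : Fin N, ∑ e : Fin N, (if a = b then ‖φ e‖ ^ 2 / (N : ℝ) ^ 2 else 0) =
        if a = b then (∑ e, ‖φ e‖ ^ 2) / (N : ℝ) ^ 2 else 0 := by
      intro a b; split_ifs
      · rw [Finset.sum_div]
      · simp
    simp only [this, Finset.sum_ite_eq, Finset.mem_univ, if_true, Finset.sum_const,
      Finset.card_univ, Fintype.card_fin, nsmul_eq_mul]
    field_simp
  rw [hcol, ← Finset.sum_div, ← Finset.mul_sum, Complex.norm_real, Real.norm_eq_abs, sq_abs,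
    div_pow, div_pow, Real.sq_sqrt hN1.le, Real.sq_sqrt hN0.le]
  field_simp
  ring

/-- The valence bond state is normalized. -/
lemma sum_norm_akltState (hN : 2 ≤ N) (n : ℕ) (ψ : Fin N → ℂ) :
    ∑ s, ∑ e, ‖akltState N n ψ s e‖ ^ 2 = ∑ e, ‖ψ e‖ ^ 2 := by
  induction n with
  | zero => simp [akltState, bondState, Fin.snoc]
  | succ n ih =>
    rw [sum_snoc, ← ih]
    refine Finset.sum_congr rfl fun s _ => ?_
    simp only [akltState_snoc]
    exact sum_norm_siteOp N hN _

/-- The singlet part of the projector contributes a multiple of the trace of `T`, which vanishes on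
the adjoint space; only the bond term survives, and it transposes `T`. -/
lemma sum_star_mul_siteOp (hN : 2 ≤ N) {T : PairSpace N} (hT : T ∈ adjointSpace N) :
    ∑ q, star (T q) • siteOp N q = kraus N T := by
  have htr := trace_toMat_of_mem N hT
  have hN0 : (0 : ℝ) < N := by exact_mod_cast (by omega : 0 < N)
  have hc : N / Real.sqrt ((N : ℝ) ^ 2 - 1) / Real.sqrt N = Real.sqrt (N / ((N : ℝ) ^ 2 - 1)) := by
    have h1 := Real.mul_self_sqrt hN0.le
    have h0 := (Real.sqrt_pos.2 hN0).ne'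
    rw [Real.sqrt_div hN0.le, div_div, mul_comm, ← div_div]
    congr 1
    rw [div_eq_iff h0, h1]
  ext e l
  rw [Matrix.sum_apply]
  simp only [Matrix.smul_apply, siteOp_apply, smul_eq_mul, kraus, Matrix.conjTranspose_apply, hc]
  have hsum : ∀ c : ℂ, ∑ q : Fin N × Fin N, star (T q) * (c * ((if q = (l, e) then 1 else 0) -
      if q.1 = q.2 then if l = e then (1 / N : ℂ) else 0 else 0)) =
      c * (star (T (l, e)) - star (toMat N T).trace * if l = e then (1 / N : ℂ) else 0) := by
    intro c
    simp only [mul_sub, Finset.sum_sub_distrib]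
    congr 1
    · rw [Finset.sum_eq_single (l, e)]
      · simp [mul_comm]
      · intro q _ hq; simp [hq]
      · simp
    · simp only [Fintype.sum_prod_type, Matrix.trace, Matrix.diag, toMat, Matrix.of_apply,
        star_sum, Finset.sum_mul, Finset.mul_sum]
      refine Finset.sum_congr rfl fun a _ => ?_
      simp only [mul_ite, mul_zero, Finset.sum_ite_eq, Finset.mem_univ, if_true]
      split_ifs <;> ring
  rw [hsum, htr]
  simp [toMat]

lemma postState_snoc (hN : 2 ≤ N) (n : ℕ) (B : List (Label N) → SiteBasis N) (ψ : Fin N → ℂ)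
    (o : Fin n → Label N) (α : Label N) :
    postState N (n + 1) B ψ (Fin.snoc o α) =
      kraus N (B (List.ofFn o) α) *ᵥ postState N n B ψ o := by
  have h1 : ∀ k : Fin n, (List.ofFn o ++ [α]).take k.val = (List.ofFn o).take k.val := by
    intro k
    rw [List.take_append_of_le_length (by simp [k.isLt.le])]
  have h2 : (List.ofFn o ++ [α]).take n = List.ofFn o := by
    rw [List.take_append_of_le_length (by simp), List.take_of_length_le (by simp)]
  rw [← sum_star_mul_siteOp N hN (B (List.ofFn o) α).2, Matrix.sum_mulVec]
  ext e
  simp only [postState, ofFn_snoc]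
  rw [sum_snoc, Finset.sum_comm, Finset.sum_apply]
  refine Finset.sum_congr rfl fun q _ => ?_
  simp only [Fin.prod_univ_castSucc, Fin.snoc_castSucc, Fin.snoc_last, Fin.val_castSucc,
    Fin.val_last, h1, h2, akltState_snoc, Matrix.mulVec, dotProduct, Matrix.smul_apply, smul_eq_mul,
    Finset.mul_sum]
  rw [Finset.sum_comm]
  refine Finset.sum_congr rfl fun l _ => ?_
  rw [postState, Finset.mul_sum]
  refine Finset.sum_congr rfl fun s _ => ?_
  ring

omit [NeZero N] in
lemma virtualOp_snoc (n : ℕ) (B : List (Label N) → SiteBasis N) (o : Fin n → Label N)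
    (α : Label N) :
    virtualOp N (n + 1) B (Fin.snoc o α) = kraus N (B (List.ofFn o) α) * virtualOp N n B o := by
  have h1 : ∀ k : Fin n, (List.ofFn o ++ [α]).take k.val = (List.ofFn o).take k.val := by
    intro k
    rw [List.take_append_of_le_length (by simp [k.isLt.le])]
  have h2 : (List.ofFn o ++ [α]).take n = List.ofFn o := by
    rw [List.take_append_of_le_length (by simp), List.take_of_length_le (by simp)]
  simp only [virtualOp, ofFn_snoc]
  rw [List.ofFn_succ']
  simp [h1, h2]

/-- The outcomes act on the virtual space by the product of their Kraus operators. -/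
lemma postState_eq_virtualOp_mulVec (hN : 2 ≤ N) (n : ℕ) (B : List (Label N) → SiteBasis N)
    (ψ : Fin N → ℂ) (o : Fin n → Label N) :
    postState N n B ψ o = virtualOp N n B o *ᵥ ψ := by
  induction n with
  | zero =>
    ext e
    simp [postState, virtualOp, akltState, bondState, Fin.snoc]
  | succ n ih =>
    rw [← Fin.snoc_init_self o, postState_snoc N hN, virtualOp_snoc, ih, Matrix.mulVec_mulVec]

end Chain

/-! ### Induced gates -/

section Gates

variable (N : ℕ) [NeZero N]

omit [NeZero N] in
lemma card_graph (g : Fin N → Fin N) :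
    Fintype.card {p : Fin N × Fin N // p.1 = g p.2} = N := by
  have e : {p : Fin N × Fin N // p.1 = g p.2} ≃ Fin N :=
    { toFun := fun p => p.1.2
      invFun := fun b => ⟨(g b, b), rfl⟩
      left_inv := fun p => by ext <;> simp [p.2]
      right_inv := fun b => rfl }
  rw [Fintype.card_congr e, Fintype.card_fin]

lemma shiftX_clockZ_pow (j m : ℕ) :
    ∃ c : ℂ, c ≠ 0 ∧ (shiftX N ^ j * clockZ N) ^ m = c • (shiftX N ^ (m * j) * clockZ N ^ m) := by
  induction m with
  | zero => exact ⟨1, one_ne_zero, by simp⟩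
  | succ m ih =>
    obtain ⟨c, hc, h⟩ := ih
    have h0 := rootN_ne_zero N
    refine ⟨c * (rootN N)⁻¹ ^ (m * j), by positivity, ?_⟩
    have h1 := shiftX_clockZ_mul N (m * j) m j 1
    rw [pow_one] at h1
    rw [pow_succ, h, smul_mul_assoc, h1, smul_smul, add_mul, one_mul]

/-- An axis operator commutes with each Heisenberg–Weyl operator up to a scalar `ζ p`. The scalar is
`1` for exactly `N` of them, and these are proportional to powers of the axis operator. -/
lemma axisOperators_commutation {O : Matrix (Fin N) (Fin N) ℂ} (hO : O ∈ axisOperators N) :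
    ∃ ζ : Fin N × Fin N → ℂ, (∀ p, O * hw N p = ζ p • (hw N p * O)) ∧
      (∀ p, ζ p = 1 → ∃ (c : ℂ) (m : ℕ), hw N p = c • O ^ m) ∧
      Nat.card {p // ζ p = 1} = N := by
  have h0 := rootN_ne_zero N
  have hprim := isPrimitiveRoot_rootN N
  rcases hO with rfl | ⟨j, rfl⟩
  · have hone : ∀ p : Fin N × Fin N, rootN N ^ p.2.val = 1 ↔ p.2 = 0 := by
      intro p
      constructor
      · intro h
        have := hprim.pow_inj p.2.isLt (Nat.pos_of_ne_zero (NeZero.ne N)) (by simpa using h)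
        exact Fin.ext (by simpa using this)
      · intro h; simp [h]
    refine ⟨fun p => rootN N ^ p.2.val, fun p => ?_, fun p hp => ?_, ?_⟩
    · have h1 := shiftX_clockZ_mul N 1 0 p.1.val p.2.val
      have h2 := shiftX_clockZ_mul N p.1.val p.2.val 1 0
      simp only [pow_one, pow_zero, mul_one, zero_mul, one_smul, add_zero, zero_add] at h1 h2
      rw [hw, h1, h2, smul_smul, inv_pow, mul_inv_cancel₀ (pow_ne_zero _ h0), one_smul, add_comm]
    · refine ⟨1, p.1.val, ?_⟩
      rw [hone] at hp
      simp [hw, hp]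
    · simp only [hone]
      rw [Nat.card_eq_fintype_card]
      exact (Fintype.card_congr ((Equiv.prodComm _ _).subtypeEquiv fun p => Iff.rfl)).trans
        (card_graph N fun _ => 0)
  -- For `X ^ j Z` the phase is trivial exactly on the line `p.1 = p.2 * j`, which consists of the
  -- exponents of the powers of `X ^ j Z`.
  · have hone : ∀ p : Fin N × Fin N,
        rootN N ^ (p.2.val * j.val) * (rootN N)⁻¹ ^ p.1.val = 1 ↔ p.1 = p.2 * j := by
      intro p
      rw [inv_pow, mul_inv_eq_one₀ (pow_ne_zero _ h0), ← rootN_pow_mod N (_ * _), ← Fin.val_mul]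
      constructor
      · intro h
        exact Fin.ext (hprim.pow_inj (p.2 * j).isLt p.1.isLt h).symm
      · intro h; rw [h]
    refine ⟨fun p => rootN N ^ (p.2.val * j.val) * (rootN N)⁻¹ ^ p.1.val, fun p => ?_,
      fun p hp => ?_, ?_⟩
    · have h1 := shiftX_clockZ_mul N j.val 1 p.1.val p.2.val
      have h2 := shiftX_clockZ_mul N p.1.val p.2.val j.val 1
      simp only [pow_one, one_mul] at h1 h2
      rw [hw, h1, h2, smul_smul, mul_right_comm, inv_pow _ (_ * _),
        mul_inv_cancel₀ (pow_ne_zero _ h0), one_mul, add_comm j.val, add_comm 1]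
    · obtain ⟨c, hc, h⟩ := shiftX_clockZ_pow N j.val p.2.val
      refine ⟨c⁻¹, p.2.val, ?_⟩
      rw [h, smul_smul, inv_mul_cancel₀ hc, one_smul, hw, (hone p).1 hp, Fin.val_mul,
        shiftX_pow_mod]
    · simp only [hone]
      rw [Nat.card_eq_fintype_card]
      exact card_graph N fun b => b * j

lemma axisOperators_mem_unitaryGroup {O : Matrix (Fin N) (Fin N) ℂ} (hO : O ∈ axisOperators N) :
    O ∈ Matrix.unitaryGroup (Fin N) ℂ := by
  rcases hO with rfl | ⟨j, rfl⟩
  · exact shiftX_mem_unitaryGroup N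
  · exact mul_mem (pow_mem (shiftX_mem_unitaryGroup N) _) (clockZ_mem_unitaryGroup N)

variable {N}

omit [NeZero N] in
lemma IsElementaryGate.mem_unitaryGroup {V : Matrix (Fin N) (Fin N) ℂ} (hV : IsElementaryGate N V) :
    V ∈ Matrix.unitaryGroup (Fin N) ℂ := by
  obtain ⟨O, hO, v, μ, z, hv, hz, hOv, rfl⟩ := (isElementaryGate_iff N V).1 hV
  exact refl_mem_unitaryGroup hv hz

/-- Commuting with the axis operator up to a scalar, a Heisenberg–Weyl operator maps its
eigenvectors to eigenvectors. This keeps byproduct-corrected gates elementary. -/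
lemma IsElementaryGate.conj_hw {V : Matrix (Fin N) (Fin N) ℂ} (hV : IsElementaryGate N V)
    (p : Fin N × Fin N) : IsElementaryGate N (hw N p * V * (hw N p)ᴴ) := by
  obtain ⟨O, hO, v, μ, z, hv, hz, hOv, rfl⟩ := (isElementaryGate_iff N V).1 hV
  obtain ⟨ζ, hζ, -, -⟩ := axisOperators_commutation N hO
  rw [conj_refl (hw_mem_unitaryGroup N p)]
  refine (isElementaryGate_iff N _).2 ⟨O, hO, hw N p *ᵥ v, ζ p * μ, z, ?_, hz, ?_, rfl⟩
  · intro h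
    have := dotProduct_mulVec_unitary (hw_mem_unitaryGroup N p) v v
    rw [h] at this
    exact dotProduct_self_ne_zero hv (by simpa using this.symm)
  · rw [Matrix.mulVec_mulVec, hζ, Matrix.smul_mulVec, ← Matrix.mulVec_mulVec, hOv,
      Matrix.mulVec_smul, smul_smul]

lemma isElementaryGate_one : IsElementaryGate N (1 : Matrix (Fin N) (Fin N) ℂ) := by
  refine (isElementaryGate_iff N _).2 ⟨clockZ N, Or.inr ⟨0, by simp⟩, Pi.single 0 1, 1, 1, ?_,
    by simp, ?_, by simp⟩
  · simp
  · ext l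
    rw [clockZ, Matrix.mulVec_diagonal]
    by_cases hl : l = 0
    · subst hl; simp
    · simp [hl]

lemma conjTranspose_hw_mem_unitaryGroup (p : Fin N × Fin N) :
    (hw N p)ᴴ ∈ Matrix.unitaryGroup (Fin N) ℂ :=
  Unitary.star_mem (hw_mem_unitaryGroup N p)

lemma inducedGate_refl (v : Fin N → ℂ) (z : ℂ) (α : Label N) :
    inducedGate N (refl v z) α = refl ((hw N α.1)ᴴ *ᵥ v) (star z) * refl v z := by
  rw [inducedGate, refl_conjTranspose]
  have := conj_refl (conjTranspose_hw_mem_unitaryGroup α.1) v (star z)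
  rw [Matrix.conjTranspose_conjTranspose] at this
  rw [this]

/-- A group commutator has determinant one, even when the determinants of `V` and `W` are different
from one. -/
lemma inducedGate_mem_specialUnitaryGroup {V : Matrix (Fin N) (Fin N) ℂ}
    (hV : V ∈ Matrix.unitaryGroup (Fin N) ℂ) (α : Label N) :
    inducedGate N V α ∈ Matrix.specialUnitaryGroup (Fin N) ℂ := by
  rw [Matrix.mem_specialUnitaryGroup_iff]
  have hW := hw_mem_unitaryGroup N α.1
  refine ⟨mul_mem (mul_mem (mul_mem (conjTranspose_hw_mem_unitaryGroup α.1)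
    (Unitary.star_mem hV)) hW) hV, ?_⟩
  have h1 := congrArg Matrix.det (Matrix.mem_unitaryGroup_iff.1 hW)
  have h2 := congrArg Matrix.det (Matrix.mem_unitaryGroup_iff.1 hV)
  rw [Matrix.det_mul, Matrix.det_one, Matrix.star_eq_conjTranspose] at h1 h2
  rw [inducedGate, Matrix.det_mul, Matrix.det_mul, Matrix.det_mul]
  linear_combination (V.det * Vᴴ.det) * h1 + h2

lemma inducedGate_eq_one_iff_commute {V : Matrix (Fin N) (Fin N) ℂ}
    (hV : V ∈ Matrix.unitaryGroup (Fin N) ℂ) (α : Label N) :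
    inducedGate N V α = 1 ↔ Commute V (hw N α.1) := by
  have h1 := Matrix.mem_unitaryGroup_iff.1 hV
  have h2 := Matrix.mem_unitaryGroup_iff'.1 hV
  have h3 := Matrix.mem_unitaryGroup_iff.1 (hw_mem_unitaryGroup N α.1)
  have h4 := Matrix.mem_unitaryGroup_iff'.1 (hw_mem_unitaryGroup N α.1)
  rw [Matrix.star_eq_conjTranspose] at h1 h2 h3 h4
  constructor
  · intro h
    have h5 := hw_mul_inducedGate N V α
    rw [h, mul_one] at h5
    rw [Commute, SemiconjBy]
    conv_lhs => rw [h5]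
    simp only [← mul_assoc, h1, one_mul]
  · intro h
    rw [inducedGate, mul_assoc, ← h.eq]
    simp only [mul_assoc]
    rw [← mul_assoc Vᴴ, h2, one_mul, h4]

/-- The two vectors are eigenvectors of the unitary `O` for the distinct eigenvalues `ζ μ` and `μ`.
-/
lemma dotProduct_hw_eq_zero {O : Matrix (Fin N) (Fin N) ℂ} (hO : O ∈ axisOperators N)
    {v : Fin N → ℂ} {μ ζ : ℂ} (hv : v ≠ 0) (hOv : O *ᵥ v = μ • v) {p : Fin N × Fin N}
    (hζ : O * hw N p = ζ • (hw N p * O)) (hζ1 : ζ ≠ 1) : star (hw N p *ᵥ v) ⬝ᵥ v = 0 := by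
  have hU := axisOperators_mem_unitaryGroup N hO
  have hμ : star μ * μ = 1 := by
    have := dotProduct_mulVec_unitary hU v v
    rw [hOv, star_smul, smul_dotProduct, dotProduct_smul, smul_smul] at this
    exact mul_right_cancel₀ (dotProduct_self_ne_zero hv) (by simpa using this)
  have hOW : O *ᵥ (hw N p *ᵥ v) = (ζ * μ) • (hw N p *ᵥ v) := by
    rw [Matrix.mulVec_mulVec, hζ, Matrix.smul_mulVec, ← Matrix.mulVec_mulVec, hOv,
      Matrix.mulVec_smul, smul_smul]
  have h := dotProduct_mulVec_unitary hU (hw N p *ᵥ v) v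
  rw [hOW, hOv, star_smul, smul_dotProduct, dotProduct_smul, smul_smul, star_mul', mul_assoc, hμ,
    mul_one, smul_eq_mul] at h
  have hζ' : star ζ - 1 ≠ 0 := fun h' => hζ1 (by
    have := congrArg star (sub_eq_zero.1 h')
    simpa using this)
  refine (mul_eq_zero.1 ?_).resolve_left hζ'
  rw [sub_mul, one_mul, h, sub_self]

omit [NeZero N] in
lemma star_conjTranspose_mulVec_dotProduct (W : Matrix (Fin N) (Fin N) ℂ) (v w : Fin N → ℂ) :
    star (Wᴴ *ᵥ v) ⬝ᵥ w = star v ⬝ᵥ (W *ᵥ w) := by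
  rw [Matrix.star_mulVec, Matrix.conjTranspose_conjTranspose, ← Matrix.dotProduct_mulVec]

/-- The gate induced by an elementary gate `V ≠ 1` is trivial for the labels whose
Heisenberg–Weyl operator commutes with the axis operator; for the others it acts on two orthogonal
vectors by conjugate phases. -/
lemma inducedGate_dichotomy {O : Matrix (Fin N) (Fin N) ℂ} (hO : O ∈ axisOperators N)
    {v : Fin N → ℂ} {μ z : ℂ} (hv : v ≠ 0) (hz : ‖z‖ = 1) (hOv : O *ᵥ v = μ • v)
    {ζ : Fin N × Fin N → ℂ} (hζ : ∀ p, O * hw N p = ζ p • (hw N p * O))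
    (hpow : ∀ p, ζ p = 1 → ∃ (c : ℂ) (m : ℕ), hw N p = c • O ^ m) (α : Label N) :
    (ζ α.1 = 1 → inducedGate N (refl v z) α = 1) ∧
    (ζ α.1 ≠ 1 → star ((hw N α.1)ᴴ *ᵥ v) ⬝ᵥ v = 0) := by
  constructor
  · intro h1
    obtain ⟨c, m, hW⟩ := hpow _ h1
    have hOm : (O ^ m) *ᵥ v = μ ^ m • v := by
      clear hW
      induction m with
      | zero => simp
      | succ m ih =>
        rw [pow_succ, ← Matrix.mulVec_mulVec, hOv, Matrix.mulVec_smul, ih, smul_smul, pow_succ,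
          mul_comm]
    have hWv : hw N α.1 *ᵥ v = (c * μ ^ m) • v := by
      rw [hW, Matrix.smul_mulVec, hOm, smul_smul]
    have hU := Matrix.mem_unitaryGroup_iff'.1 (hw_mem_unitaryGroup N α.1)
    rw [Matrix.star_eq_conjTranspose] at hU
    have hv' : v = (c * μ ^ m) • ((hw N α.1)ᴴ *ᵥ v) := by
      rw [← Matrix.mulVec_smul, ← hWv, Matrix.mulVec_mulVec, hU, Matrix.one_mulVec]
    have hne : c * μ ^ m ≠ 0 := by
      intro h; rw [h, zero_smul] at hv'; exact hv hv'
    have hr : refl ((hw N α.1)ᴴ *ᵥ v) (star z) = refl v (star z) := by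
      conv_rhs => rw [hv']
      rw [refl_smul hne]
    rw [inducedGate_refl, hr, refl_mul hv, Complex.star_def, Complex.conj_mul', hz]
    simp
  · intro h1
    have := dotProduct_hw_eq_zero hO hv hOv (hζ α.1) h1
    rw [star_conjTranspose_mulVec_dotProduct, ← star_dotProduct_comm, this, star_zero]

lemma inducedGate_mulVec_self {v : Fin N → ℂ} (hv : v ≠ 0) (z : ℂ) (α : Label N)
    (h : star ((hw N α.1)ᴴ *ᵥ v) ⬝ᵥ v = 0) : inducedGate N (refl v z) α *ᵥ v = z • v := by
  have h0 := dotProduct_self_ne_zero hv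
  have h1 : refl v z *ᵥ v = z • v := by
    rw [refl_mulVec, mul_div_assoc, div_self h0, mul_one, sub_smul, one_smul]; abel
  rw [inducedGate_refl, ← Matrix.mulVec_mulVec, h1, Matrix.mulVec_smul, refl_mulVec, h]
  simp

lemma inducedGate_eq_one_iff {O : Matrix (Fin N) (Fin N) ℂ} (hO : O ∈ axisOperators N)
    {v : Fin N → ℂ} {μ z : ℂ} (hv : v ≠ 0) (hz : ‖z‖ = 1) (hz1 : z ≠ 1) (hOv : O *ᵥ v = μ • v)
    {ζ : Fin N × Fin N → ℂ} (hζ : ∀ p, O * hw N p = ζ p • (hw N p * O))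
    (hpow : ∀ p, ζ p = 1 → ∃ (c : ℂ) (m : ℕ), hw N p = c • O ^ m) (α : Label N) :
    inducedGate N (refl v z) α = 1 ↔ ζ α.1 = 1 := by
  obtain ⟨h1, h2⟩ := inducedGate_dichotomy hO hv hz hOv hζ hpow α
  refine ⟨fun h => ?_, h1⟩
  by_contra h3
  have h4 := inducedGate_mulVec_self hv z α (h2 h3)
  rw [h, Matrix.one_mulVec] at h4
  have h5 : (z - 1) • v = 0 := by rw [sub_smul, ← h4, one_smul, sub_self]
  rcases smul_eq_zero.1 h5 with h6 | h6
  · exact hz1 (sub_eq_zero.1 h6)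
  · exact hv h6

/-- A nontrivial induced gate multiplies the orthogonal vectors `v` and `W†v` by `z` and `z̄`. If it
is a scalar, then `z` is real, so `z² = 1` and `V² = 1`. For `N > 2` the trace excludes this too, as
the gate fixes the complement of the two vectors. -/
lemma IsElementaryGate.inducedGate_not_scalar {V : Matrix (Fin N) (Fin N) ℂ}
    (hV : IsElementaryGate N V) (α : Label N) (h : 2 < N ∨ V * V ≠ 1)
    (hne : inducedGate N V α ≠ 1) (s : ℂ) : inducedGate N V α ≠ s • 1 := by
  obtain ⟨O, hO, v, μ, z, hv, hz, hOv, rfl⟩ := (isElementaryGate_iff N V).1 hV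
  obtain ⟨ζ, hζ, hpow, -⟩ := axisOperators_commutation N hO
  obtain ⟨h1, h2⟩ := inducedGate_dichotomy hO hv hz hOv hζ hpow α
  have horth := h2 fun h3 => hne (h1 h3)
  intro hs
  have e1 := inducedGate_mulVec_self hv z α horth
  rw [hs, Matrix.smul_mulVec, Matrix.one_mulVec] at e1
  have hsz : s = z := smul_left_injective ℂ hv e1
  subst hsz
  set u := (hw N α.1)ᴴ *ᵥ v with hu
  have huu : star u ⬝ᵥ u = star v ⬝ᵥ v :=
    dotProduct_mulVec_unitary (conjTranspose_hw_mem_unitaryGroup α.1) v v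
  have hvu : star v ⬝ᵥ u = 0 := by rw [← star_dotProduct_comm, horth, star_zero]
  have hv0 := dotProduct_self_ne_zero hv
  have hu0 : u ≠ 0 := by
    intro h0; rw [h0] at huu; exact hv0 (by simpa using huu.symm)
  have e2 : inducedGate N (refl v s) α *ᵥ u = star s • u := by
    rw [inducedGate_refl, ← hu, ← Matrix.mulVec_mulVec, refl_mulVec v, hvu, mul_zero, zero_div,
      zero_smul, add_zero, refl_mulVec, mul_div_assoc, div_self (dotProduct_self_ne_zero hu0),
      mul_one, sub_smul, one_smul]
    abel
  rw [hs, Matrix.smul_mulVec, Matrix.one_mulVec] at e2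
  have hss : s = star s := smul_left_injective ℂ hu0 e2
  have hs2 : s * s = 1 := by
    nth_rewrite 1 [hss]
    rw [Complex.star_def, Complex.conj_mul', hz]; simp
  rcases h with h | h
  · have htr : (inducedGate N (refl v s) α).trace = N + 2 * (s - 1) := by
      rw [inducedGate_refl, ← hu, ← hss, refl, refl, mul_add, mul_one, add_mul, one_mul, mul_smul_comm,
        smul_mul_assoc, Matrix.vecMulVec_mul_vecMulVec, horth, huu]
      simp only [Matrix.trace_add, Matrix.trace_smul, Matrix.trace_one, Matrix.trace_vecMulVec,
        Fintype.card_fin, zero_smul, Matrix.vecMulVec_zero, smul_zero, add_zero]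
      rw [dotProduct_comm u, dotProduct_comm v, huu]
      simp only [smul_eq_mul]
      field_simp
      ring
    rw [hs, Matrix.trace_smul, Matrix.trace_one, Fintype.card_fin, smul_eq_mul] at htr
    have h3 : (s - 1) * ((N : ℂ) - 2) = 0 := by linear_combination htr
    have hN2 : (N : ℂ) - 2 ≠ 0 := by
      rw [sub_ne_zero]; exact_mod_cast h.ne'
    have hs1 : s = 1 := sub_eq_zero.1 ((mul_eq_zero.1 h3).resolve_right hN2)
    exact hne (by rw [hs, hs1, one_smul])
  · exact h (by rw [refl_mul hv, hs2, refl_one])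

open Classical in
/-- The number of outcomes for which the induced gate is nontrivial. -/
lemma IsElementaryGate.card_nontrivial {V : Matrix (Fin N) (Fin N) ℂ} (hV : IsElementaryGate N V)
    (h1 : V ≠ 1) :
    (Finset.univ.filter fun α : Label N => inducedGate N V α ≠ 1).card = N ^ 2 - N := by
  obtain ⟨O, hO, v, μ, z, hv, hz, hOv, rfl⟩ := (isElementaryGate_iff N V).1 hV
  obtain ⟨ζ, hζ, hpow, hcard⟩ := axisOperators_commutation N hO
  have hz1 : z ≠ 1 := by rintro rfl; simp at h1
  have hζ0 : ζ 0 = 1 := by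
    have h := hζ 0
    rw [hw_zero, mul_one, one_mul] at h
    have hO0 : O ≠ 0 := by
      rintro rfl
      have := Matrix.mem_unitaryGroup_iff.1 (axisOperators_mem_unitaryGroup N hO)
      simp at this
    have : (ζ 0 - 1) • O = 0 := by rw [sub_smul, one_smul, ← h, sub_self]
    exact sub_eq_zero.1 ((smul_eq_zero.1 this).resolve_right hO0)
  -- Labels omit the pair `(0, 0)`, but its phase is trivial, so the nontrivial labels are all the
  -- pairs with nontrivial phase.
  have himg : (Finset.univ.filter fun α : Label N => inducedGate N (refl v z) α ≠ 1).map
      (Function.Embedding.subtype _) = Finset.univ.filter fun p : Fin N × Fin N => ¬ ζ p = 1 := by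
    ext p
    simp only [Finset.mem_map, Finset.mem_filter, Finset.mem_univ, true_and,
      Function.Embedding.subtype_apply]
    constructor
    · rintro ⟨α, hα, rfl⟩
      rwa [ne_eq, inducedGate_eq_one_iff hO hv hz hz1 hOv hζ hpow] at hα
    · intro hp
      have hp0 : ¬ (p.1.val = 0 ∧ p.2.val = 0) := by
        rintro ⟨ha, hb⟩
        have : p = 0 := Prod.ext (Fin.ext ha) (Fin.ext hb)
        exact hp (this ▸ hζ0)
      refine ⟨⟨p, hp0⟩, ?_, rfl⟩
      rwa [ne_eq, inducedGate_eq_one_iff hO hv hz hz1 hOv hζ hpow]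
  rw [← Finset.card_map, himg]
  have h2 := Finset.card_filter_add_card_filter_not (s := (Finset.univ : Finset (Fin N × Fin N)))
    (fun p => ζ p = 1)
  rw [Nat.card_eq_fintype_card, Fintype.card_subtype] at hcard
  rw [hcard, Finset.card_univ, Fintype.card_prod, Fintype.card_fin] at h2
  rw [sq]
  omega

end Gates

/-! ### Adaptive schemes -/

section Schemes

variable {N : ℕ} [NeZero N]

omit [NeZero N] in
lemma natCast_sq_sub_one_pos (hN : 2 ≤ N) : (0 : ℝ) < (N : ℝ) ^ 2 - 1 := by
  have : (2 : ℝ) ≤ N := by exact_mod_cast hN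
  nlinarith

lemma GateProtocol.kraus_basis (P : GateProtocol N) (hN : 2 ≤ N) (h : List (Label N))
    (α : Label N) :
    kraus N (P.basis h α) = ((1 / Real.sqrt ((N : ℝ) ^ 2 - 1) : ℝ) : ℂ) •
      (hw N α.1 * inducedGate N (P.gate h) α) := by
  rw [kraus_of_isRotatedBy N hN (P.rotated h), hw_mul_inducedGate]

/-- The Kraus operator is a unitary divided by `√(N² - 1)`, so it scales all norms alike, whatever
the state. -/
lemma GateProtocol.prob_snoc (P : GateProtocol N) (hN : 2 ≤ N) (n : ℕ) (ψ : Fin N → ℂ)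
    (o : Fin n → Label N) (α : Label N) :
    prob N (n + 1) P.basis ψ (Fin.snoc o α) =
      1 / ((N : ℝ) ^ 2 - 1) * prob N n P.basis ψ o := by
  have hpos := natCast_sq_sub_one_pos hN
  have hU : hw N α.1 * inducedGate N (P.gate (List.ofFn o)) α ∈ Matrix.unitaryGroup (Fin N) ℂ :=
    mul_mem (hw_mem_unitaryGroup N _) (Matrix.specialUnitaryGroup_le_unitaryGroup
      (inducedGate_mem_specialUnitaryGroup (P.elementary _).mem_unitaryGroup α))
  have hnorm := dotProduct_mulVec_unitary hU (postState N n P.basis ψ o) (postState N n P.basis ψ o)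
  rw [dotProduct_self_eq_sum, dotProduct_self_eq_sum, Complex.ofReal_inj] at hnorm
  rw [prob, prob, postState_snoc N hN, P.kraus_basis hN, Matrix.smul_mulVec, ← hnorm,
    Finset.mul_sum]
  refine Finset.sum_congr rfl fun e _ => ?_
  rw [Pi.smul_apply, norm_smul, mul_pow, Complex.norm_real, Real.norm_eq_abs, sq_abs, div_pow,
    one_pow, Real.sq_sqrt hpos.le]

/-- The outcomes of an adaptive scheme are uniformly distributed. -/
lemma GateProtocol.prob_eq (P : GateProtocol N) (hN : 2 ≤ N) (n : ℕ) (ψ : Fin N → ℂ)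
    (hψ : ∑ e, ‖ψ e‖ ^ 2 = 1) (o : Fin n → Label N) :
    prob N n P.basis ψ o = (1 / ((N : ℝ) ^ 2 - 1)) ^ n := by
  induction n with
  | zero =>
    rw [prob, postState_eq_virtualOp_mulVec N hN]
    simpa [virtualOp] using hψ
  | succ n ih => rw [← Fin.snoc_init_self o, P.prob_snoc hN, ih, ← pow_succ']

lemma conj_hw_mem_specialUnitaryGroup {G : Matrix (Fin N) (Fin N) ℂ}
    (hG : G ∈ Matrix.specialUnitaryGroup (Fin N) ℂ) (b : Fin N × Fin N) :
    (hw N b)ᴴ * G * hw N b ∈ Matrix.specialUnitaryGroup (Fin N) ℂ := by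
  rw [Matrix.mem_specialUnitaryGroup_iff] at hG ⊢
  have hW := hw_mem_unitaryGroup N b
  refine ⟨mul_mem (mul_mem (conjTranspose_hw_mem_unitaryGroup b) hG.1) hW, ?_⟩
  have h1 := congrArg Matrix.det (Matrix.mem_unitaryGroup_iff.1 hW)
  rw [Matrix.det_mul, Matrix.det_one, Matrix.star_eq_conjTranspose] at h1
  rw [Matrix.det_mul, Matrix.det_mul, hG.2]
  linear_combination h1

lemma hw_mul_conjTranspose (b : Fin N × Fin N) : hw N b * (hw N b)ᴴ = 1 :=
  Matrix.mem_unitaryGroup_iff.1 (hw_mem_unitaryGroup N b)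

lemma conjTranspose_hw_mul (b : Fin N × Fin N) : (hw N b)ᴴ * hw N b = 1 :=
  Matrix.mem_unitaryGroup_iff'.1 (hw_mem_unitaryGroup N b)

omit [NeZero N] in
lemma krausScale_ne_zero (hN : 2 ≤ N) :
    ((1 / Real.sqrt ((N : ℝ) ^ 2 - 1) : ℝ) : ℂ) ≠ 0 := by
  have := Real.sqrt_pos.2 (natCast_sq_sub_one_pos hN)
  exact_mod_cast (one_div_pos.2 this).ne'

/-- Every sequence of outcomes performs some gate of `SU(N)`, up to a byproduct. -/
lemma GateProtocol.exists_virtualOp_eq (P : GateProtocol N) (hN : 2 ≤ N) (n : ℕ)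
    (o : Fin n → Label N) :
    ∃ G ∈ Matrix.specialUnitaryGroup (Fin N) ℂ, ∃ (b : Fin N × Fin N) (c : ℂ), c ≠ 0 ∧
      virtualOp N n P.basis o = c • (hw N b * G) := by
  induction n with
  | zero => exact ⟨1, one_mem _, 0, 1, one_ne_zero, by simp [virtualOp, hw_zero]⟩
  | succ n ih =>
    obtain ⟨G, hG, b, c, hc, h⟩ := ih (Fin.init o)
    rw [← Fin.snoc_init_self o, virtualOp_snoc, P.kraus_basis hN, h]
    set α := o (Fin.last n)
    set g := inducedGate N (P.gate (List.ofFn (Fin.init o))) α with hg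
    have hgS : g ∈ Matrix.specialUnitaryGroup (Fin N) ℂ :=
      inducedGate_mem_specialUnitaryGroup (P.elementary _).mem_unitaryGroup α
    -- Moving the old byproduct to the left conjugates the new gate: `W_α g W_b G = W_α W_b (W_b† g
    -- W_b) G`.
    refine ⟨(hw N b)ᴴ * g * hw N b * G, mul_mem (conj_hw_mem_specialUnitaryGroup hgS b) hG, α.1 + b,
      ((1 / Real.sqrt ((N : ℝ) ^ 2 - 1) : ℝ) : ℂ) * c * (rootN N)⁻¹ ^ (α.1.2.val * b.1.val),
      mul_ne_zero (mul_ne_zero (krausScale_ne_zero hN) hc)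
        (pow_ne_zero _ (inv_ne_zero (rootN_ne_zero N))), ?_⟩
    rw [mul_smul, ← smul_mul_assoc _ (hw N (α.1 + b)), ← hw_mul, smul_mul_smul_comm]
    congr 1
    simp only [mul_assoc]
    rw [← mul_assoc (hw N b) (hw N b)ᴴ, hw_mul_conjTranspose, one_mul]

/-! ### Effective gates -/

/-- The product of the gates induced by a list of outcomes, when the gate measured after the earlier
outcomes `h` is `s h` and byproducts are left aside. -/
def effOp (s : List (Label N) → Matrix (Fin N) (Fin N) ℂ) :
    List (Label N) → Matrix (Fin N) (Fin N) ℂ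
  | [] => 1
  | α :: h => effOp (fun h' => s (α :: h')) h * inducedGate N (s []) α

omit [NeZero N] in
-- The recursion of `effOp` peels off the first outcome, which suits strategies built from their
-- first measurement; the chain grows at the last outcome.
lemma effOp_append_singleton (s : List (Label N) → Matrix (Fin N) (Fin N) ℂ) (h : List (Label N))
    (α : Label N) : effOp s (h ++ [α]) = inducedGate N (s h) α * effOp s h := by
  induction h generalizing s with
  | nil => simp [effOp]
  | cons β h ih => rw [List.cons_append, effOp, ih, effOp, mul_assoc]

/-- The byproduct of a list of outcomes. -/
def byproduct (h : List (Label N)) : Fin N × Fin N := (h.map Subtype.val).sum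

/-- The scheme that measures the gates `s h`, corrected for the byproducts of the earlier
outcomes. -/
def correctedProtocol (s : List (Label N) → Matrix (Fin N) (Fin N) ℂ)
    (hs : ∀ h, IsElementaryGate N (s h)) : GateProtocol N where
  gate h := hw N (byproduct h) * s h * (hw N (byproduct h))ᴴ
  basis h := (exists_rotated N ((hs h).conj_hw (byproduct h)).mem_unitaryGroup).choose
  elementary h := (hs h).conj_hw _
  rotated h := (exists_rotated N ((hs h).conj_hw (byproduct h)).mem_unitaryGroup).choose_spec

lemma hw_mul_comm (p q : Fin N × Fin N) :
    ∃ κ : ℂ, κ ≠ 0 ∧ hw N p * hw N q = κ • (hw N q * hw N p) := by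
  have h0 := rootN_ne_zero N
  refine ⟨(rootN N)⁻¹ ^ (p.2.val * q.1.val) * rootN N ^ (q.2.val * p.1.val), by positivity, ?_⟩
  rw [hw_mul, hw_mul, smul_smul, mul_assoc, inv_pow _ (q.2.val * p.1.val),
    mul_inv_cancel₀ (pow_ne_zero _ h0), mul_one, add_comm]

/-- The phase `κ` from moving `W_b` past `W_α` cancels against the one from `W_α†`. So a gate
conjugated by the byproduct acts behind that byproduct as the uncorrected gate would. -/
lemma inducedGate_conj_mul (V : Matrix (Fin N) (Fin N) ℂ) (b : Fin N × Fin N) (α : Label N) :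
    inducedGate N (hw N b * V * (hw N b)ᴴ) α * hw N b = hw N b * inducedGate N V α := by
  obtain ⟨κ, hκ, hcomm⟩ := hw_mul_comm b α.1
  have h1 : (hw N α.1)ᴴ * hw N b = κ • (hw N b * (hw N α.1)ᴴ) := by
    calc (hw N α.1)ᴴ * hw N b = (hw N α.1)ᴴ * (hw N b * hw N α.1) * (hw N α.1)ᴴ := by
          simp only [mul_assoc, hw_mul_conjTranspose, mul_one]
      _ = _ := by
          rw [hcomm, mul_smul_comm, smul_mul_assoc, ← mul_assoc, conjTranspose_hw_mul, one_mul]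
  have h2 : κ • ((hw N b)ᴴ * hw N α.1) = hw N α.1 * (hw N b)ᴴ := by
    calc κ • ((hw N b)ᴴ * hw N α.1) =
        (hw N b)ᴴ * (κ • (hw N α.1 * hw N b)) * (hw N b)ᴴ := by
          rw [mul_smul_comm, smul_mul_assoc]
          simp only [mul_assoc, hw_mul_conjTranspose, mul_one]
      _ = _ := by rw [← hcomm, ← mul_assoc, conjTranspose_hw_mul, one_mul]
  rw [inducedGate, inducedGate, Matrix.conjTranspose_mul, Matrix.conjTranspose_mul,
    Matrix.conjTranspose_conjTranspose]
  calc (hw N α.1)ᴴ * (hw N b * (Vᴴ * (hw N b)ᴴ)) * hw N α.1 * (hw N b * V * (hw N b)ᴴ) * hw N b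
      = (hw N α.1)ᴴ * hw N b * Vᴴ * ((hw N b)ᴴ * hw N α.1) * hw N b * V := by
        simp only [mul_assoc, conjTranspose_hw_mul, mul_one]
    _ = hw N b * (hw N α.1)ᴴ * Vᴴ * (κ • ((hw N b)ᴴ * hw N α.1)) * hw N b * V := by
        rw [h1]; simp only [smul_mul_assoc, mul_smul_comm]
    _ = _ := by
        rw [h2]
        simp only [mul_assoc]
        rw [← mul_assoc (hw N b)ᴴ, conjTranspose_hw_mul, one_mul]

/-- This separates byproducts, which add up to `byproduct`, from the gates; reaching a target is now
a question about `effOp` alone. -/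
lemma correctedProtocol_virtualOp (hN : 2 ≤ N) (s : List (Label N) → Matrix (Fin N) (Fin N) ℂ)
    (hs : ∀ h, IsElementaryGate N (s h)) (n : ℕ) (o : Fin n → Label N) :
    ∃ c : ℂ, c ≠ 0 ∧ virtualOp N n (correctedProtocol s hs).basis o =
      c • (hw N (byproduct (List.ofFn o)) * effOp s (List.ofFn o)) := by
  induction n with
  | zero => exact ⟨1, one_ne_zero, by simp [virtualOp, byproduct, effOp, hw_zero]⟩
  | succ n ih =>
    obtain ⟨c, hc, h⟩ := ih (Fin.init o)
    rw [← Fin.snoc_init_self o, virtualOp_snoc, GateProtocol.kraus_basis _ hN, h, ofFn_snoc,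
      effOp_append_singleton]
    set α := o (Fin.last n)
    set h' := List.ofFn (Fin.init o)
    have hb : byproduct (h' ++ [α]) = α.1 + byproduct h' := by
      simp [byproduct, add_comm]
    refine ⟨((1 / Real.sqrt ((N : ℝ) ^ 2 - 1) : ℝ) : ℂ) * c *
      (rootN N)⁻¹ ^ (α.1.2.val * (byproduct h').1.val),
      mul_ne_zero (mul_ne_zero (krausScale_ne_zero hN) hc)
        (pow_ne_zero _ (inv_ne_zero (rootN_ne_zero N))), ?_⟩
    rw [hb, mul_smul, ← smul_mul_assoc _ (hw N (α.1 + byproduct h')), ← hw_mul, smul_mul_smul_comm]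
    congr 1
    have := inducedGate_conj_mul (s h') (byproduct h') α
    simp only [mul_assoc]
    congr 1
    rw [← mul_assoc, ← mul_assoc, ← this]
    rfl

/-! ### Performing gates with bounded failure probability -/

/-- `Performs n T q`: the target gate `T` can be performed, up to a scalar, on `n` sites with failure
probability at most `q`. -/
inductive Performs : ℕ → Matrix (Fin N) (Fin N) ℂ → ℝ → Prop
  | done {n : ℕ} {T : Matrix (Fin N) (Fin N) ℂ} {q : ℝ} (c : ℂ) (hc : c ≠ 0) (hT : T = c • 1)
      (hq : 0 ≤ q) : Performs n T q
  | giveUp {n : ℕ} {T : Matrix (Fin N) (Fin N) ℂ} {q : ℝ} (hq : 1 ≤ q) : Performs n T q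
  | measure {n : ℕ} {T : Matrix (Fin N) (Fin N) ℂ} {q : ℝ} (V : Matrix (Fin N) (Fin N) ℂ)
      (hV : IsElementaryGate N V) (r : Label N → ℝ)
      (h : ∀ α, Performs n (T * (inducedGate N V α)ᴴ) (r α))
      (hq : ∑ α, r α ≤ q * Fintype.card (Label N)) : Performs (n + 1) T q

omit [NeZero N] in
lemma card_label_pos (hN : 2 ≤ N) : 0 < (Fintype.card (Label N) : ℝ) := by
  have : Nonempty (Label N) :=
    ⟨⟨(⟨1, by omega⟩, ⟨0, by omega⟩), by simp⟩⟩
  exact_mod_cast Fintype.card_pos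

omit [NeZero N] in
lemma Performs.nonneg (hN : 2 ≤ N) {n : ℕ} {T : Matrix (Fin N) (Fin N) ℂ} {q : ℝ}
    (h : Performs n T q) : 0 ≤ q := by
  induction h with
  | done _ _ _ hq => exact hq
  | giveUp hq => linarith
  | measure V hV r h hq ih =>
    have h1 : 0 ≤ ∑ α, r α := Finset.sum_nonneg fun α _ => ih α
    exact nonneg_of_mul_nonneg_left (h1.trans hq) (card_label_pos hN)

omit [NeZero N] in
lemma Performs.mono {n : ℕ} {T : Matrix (Fin N) (Fin N) ℂ} {q : ℝ} (h : Performs n T q) (m : ℕ)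
    {c : ℂ} (hc : c ≠ 0) {q' : ℝ} (hq' : q ≤ q') : Performs (m + n) (c • T) q' := by
  induction h generalizing q' with
  | done c' hc' hT hq =>
    exact .done (c * c') (mul_ne_zero hc hc') (by rw [hT, smul_smul]) (hq.trans hq')
  | giveUp hq => exact .giveUp (hq.trans hq')
  | measure V hV r h hq ih =>
    refine .measure V hV r (fun α => ?_)
      (hq.trans (mul_le_mul_of_nonneg_right hq' (Nat.cast_nonneg _)))
    rw [smul_mul_assoc]
    exact ih α le_rfl

omit [NeZero N] in
-- The plan for `T'` is grafted onto every successful leaf of the plan for `T`, and failure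
-- probabilities add by the union bound. The scalar left at such a leaf is absorbed by
-- `Performs.mono`.
lemma Performs.mul (hN : 2 ≤ N) {n m : ℕ} {T T' : Matrix (Fin N) (Fin N) ℂ} {q q' : ℝ}
    (h : Performs n T q) (h' : Performs m T' q') : Performs (n + m) (T' * T) (q + q') := by
  induction h with
  | @done n T q c hc hT hq =>
    rw [hT, mul_smul_comm, mul_one]
    exact h'.mono n hc (by linarith)
  | giveUp hq => exact .giveUp (by linarith [h'.nonneg hN])
  | @measure n T q V hV r h hq ih =>
    rw [Nat.succ_add]
    refine .measure V hV (fun α => r α + q') (fun α => ?_) ?_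
    · rw [mul_assoc]; exact ih α
    · rw [Finset.sum_add_distrib, add_mul]
      simp only [Finset.sum_const, Finset.card_univ, nsmul_eq_mul]
      linarith

lemma inducedGate_one (α : Label N) : inducedGate N 1 α = 1 := by
  rw [inducedGate, Matrix.conjTranspose_one, mul_one, mul_one, conjTranspose_hw_mul]

lemma effOp_one (h : List (Label N)) : effOp (fun _ => 1) h = 1 := by
  induction h with
  | nil => rfl
  | cons α h ih => rw [effOp, ih, inducedGate_one, mul_one]

lemma sum_cons {A M : Type*} [Fintype A] [AddCommMonoid M] {n : ℕ} (f : (Fin (n + 1) → A) → M) :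
    ∑ t, f t = ∑ a, ∑ t : Fin n → A, f (Fin.cons a t) := by
  rw [← (Fin.consEquiv fun _ : Fin (n + 1) => A).sum_comp, Fintype.sum_prod_type]
  rfl

open Classical in
-- The decision tree is flattened into a function of the history, with the idle gate `1` below its
-- leaves. As outcomes will be uniform, failure is measured by counting outcome sequences.
lemma Performs.exists_strategy {n : ℕ} {T : Matrix (Fin N) (Fin N) ℂ} {q : ℝ}
    (h : Performs n T q) :
    ∃ s : List (Label N) → Matrix (Fin N) (Fin N) ℂ, (∀ h, IsElementaryGate N (s h)) ∧
      ∑ o : Fin n → Label N, (if ∃ c : ℂ, c ≠ 0 ∧ effOp s (List.ofFn o) = c • T then (0 : ℝ) else 1)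
        ≤ q * (Fintype.card (Label N) : ℝ) ^ n := by
  induction h with
  | done c hc hT hq =>
    refine ⟨fun _ => 1, fun _ => isElementaryGate_one, ?_⟩
    rw [Finset.sum_eq_zero]
    · positivity
    · intro o _
      rw [if_pos]
      exact ⟨c⁻¹, inv_ne_zero hc, by rw [effOp_one, hT, smul_smul, inv_mul_cancel₀ hc, one_smul]⟩
  | @giveUp n T q hq =>
    refine ⟨fun _ => 1, fun _ => isElementaryGate_one, ?_⟩
    calc _ ≤ ∑ o : Fin n → Label N, (1 : ℝ) :=
          Finset.sum_le_sum fun o _ => by split_ifs <;> norm_num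
      _ = (Fintype.card (Label N) : ℝ) ^ n := by simp
      _ ≤ _ := le_mul_of_one_le_left (by positivity) hq
  | @measure n T q V hV r h hq ih =>
    choose s hs hbound using ih
    set s' : List (Label N) → Matrix (Fin N) (Fin N) ℂ := fun h =>
      match h with
      | [] => V
      | α :: h => s α h with hs'
    refine ⟨s', ?_, ?_⟩
    · rintro (_ | ⟨α, h⟩)
      · exact hV
      · exact hs α h
    · rw [sum_cons]
      calc _ ≤ ∑ α, r α * (Fintype.card (Label N) : ℝ) ^ n := by
            refine Finset.sum_le_sum fun α _ => le_trans ?_ (hbound α)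
            refine Finset.sum_le_sum fun o _ => ?_
            rw [List.ofFn_cons, effOp]
            by_cases hgood : ∃ c : ℂ, c ≠ 0 ∧
                effOp (s α) (List.ofFn o) = c • (T * (inducedGate N V α)ᴴ)
            · rw [if_pos hgood, if_pos]
              obtain ⟨c, hc, hc'⟩ := hgood
              refine ⟨c, hc, ?_⟩
              have hG := Matrix.mem_unitaryGroup_iff'.1 (Matrix.specialUnitaryGroup_le_unitaryGroup
                (inducedGate_mem_specialUnitaryGroup hV.mem_unitaryGroup α))
              rw [Matrix.star_eq_conjTranspose] at hG
              change effOp (s α) (List.ofFn o) * inducedGate N V α = c • T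
              rw [hc', smul_mul_assoc, mul_assoc, hG, mul_one]
            · rw [if_neg hgood]
              split_ifs <;> norm_num
        _ = (∑ α, r α) * (Fintype.card (Label N) : ℝ) ^ n := by rw [Finset.sum_mul]
        _ ≤ q * Fintype.card (Label N) * (Fintype.card (Label N) : ℝ) ^ n := by gcongr
        _ = _ := by rw [pow_succ]; ring

/-- The gates that can be performed, up to a scalar, with arbitrarily small failure probability. -/
def performable (hN : 2 ≤ N) : Submonoid (Matrix (Fin N) (Fin N) ℂ) where
  carrier := {T | ∀ ε : ℝ, 0 < ε → ∃ n, Performs n T ε}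
  one_mem' := fun ε hε => ⟨0, .done 1 one_ne_zero (by simp) hε.le⟩
  mul_mem' := by
    intro T' T hT' hT ε hε
    obtain ⟨n, hn⟩ := hT (ε / 2) (by linarith)
    obtain ⟨m, hm⟩ := hT' (ε / 2) (by linarith)
    exact ⟨n + m, by simpa using hn.mul hN hm⟩

omit [NeZero N] in
lemma smul_mem_performable (hN : 2 ≤ N) {T : Matrix (Fin N) (Fin N) ℂ} (hT : T ∈ performable hN)
    {c : ℂ} (hc : c ≠ 0) : c • T ∈ performable hN := by
  intro ε hε
  obtain ⟨n, hn⟩ := hT ε hε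
  exact ⟨0 + n, hn.mono 0 hc le_rfl⟩

/-! ### Tori of commuting gates -/

/-- The matrix that is diagonal with eigenvalues `d` in the basis of the columns of `F`. -/
def torus (F : Matrix (Fin N) (Fin N) ℂ) (d : Fin N → ℂ) : Matrix (Fin N) (Fin N) ℂ :=
  F * Matrix.diagonal d * Fᴴ

omit [NeZero N] in
lemma torus_mul {F : Matrix (Fin N) (Fin N) ℂ} (hF : F ∈ Matrix.unitaryGroup (Fin N) ℂ)
    (d d' : Fin N → ℂ) : torus F d * torus F d' = torus F (d * d') := by
  have h := Matrix.mem_unitaryGroup_iff'.1 hF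
  rw [Matrix.star_eq_conjTranspose] at h
  simp only [torus, mul_assoc]
  rw [← mul_assoc Fᴴ, h, one_mul, ← mul_assoc (Matrix.diagonal d), Matrix.diagonal_mul_diagonal]
  rfl

omit [NeZero N] in
lemma torus_one {F : Matrix (Fin N) (Fin N) ℂ} (hF : F ∈ Matrix.unitaryGroup (Fin N) ℂ) :
    torus F 1 = 1 := by
  have h := Matrix.mem_unitaryGroup_iff.1 hF
  rw [Matrix.star_eq_conjTranspose] at h
  rw [torus, show (1 : Fin N → ℂ) = fun _ => 1 from rfl, Matrix.diagonal_one, mul_one, h]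

omit [NeZero N] in
-- Turns reflections along the frame into diagonal data, so that products of gates become products
-- of functions.
lemma refl_column {F : Matrix (Fin N) (Fin N) ℂ} (hF : F ∈ Matrix.unitaryGroup (Fin N) ℂ)
    (k : Fin N) (z : ℂ) : refl (F *ᵥ Pi.single k 1) z = torus F (Pi.mulSingle k z) := by
  rw [← conj_refl hF, torus]
  congr 2
  ext a b
  by_cases hab : a = b
  · subst hab
    by_cases hak : a = k
    · subst hak; simp [refl, Matrix.vecMulVec_apply]
    · simp [refl, Matrix.vecMulVec_apply, hak]
  · rw [Matrix.diagonal_apply_ne _ hab]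
    by_cases hak : a = k
    · have : b ≠ k := fun h => hab (hak.trans h.symm)
      simp [refl, Matrix.vecMulVec_apply, this, hab]
    · simp [refl, Matrix.vecMulVec_apply, hak, hab]

/-- The columns of `F` are eigenvectors of an axis operator that are permuted transitively, up to
scalars, by the Heisenberg–Weyl operators. -/
structure IsAxisFrame (F : Matrix (Fin N) (Fin N) ℂ) : Prop where
  unitary : F ∈ Matrix.unitaryGroup (Fin N) ℂ
  eigen : ∃ O ∈ axisOperators N, ∀ k, ∃ μ : ℂ, O *ᵥ (F *ᵥ Pi.single k 1) = μ • (F *ᵥ Pi.single k 1)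
  permute : ∃ σ : Label N → Fin N → Fin N,
    (∀ α k, ∃ c : ℂ, c ≠ 0 ∧
      (hw N α.1)ᴴ *ᵥ (F *ᵥ Pi.single k 1) = c • (F *ᵥ Pi.single (σ α k) 1)) ∧
    ∀ k l, k ≠ l → ∃ α, σ α k = l

lemma star_mul_self_of_norm_eq_one {z : ℂ} (hz : ‖z‖ = 1) : star z * z = 1 := by
  rw [Complex.star_def, Complex.conj_mul', hz]; simp

variable {F : Matrix (Fin N) (Fin N) ℂ}

/-- Measuring the reflection along column `k` with phase `z` puts `z` at `k` and `z̄` at `σ α k`, so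
what is left to do is the same kind of target with `k` replaced by `σ α k`. This random walk ends at
`l`, and from anywhere else at least one label leads there directly; each site thus multiplies the
failure bound by `1 - 1 / (number of labels)`. -/
lemma IsAxisFrame.performs_pair (hF : IsAxisFrame F) (hN : 2 ≤ N) {z : ℂ} (hz : ‖z‖ = 1)
    (l : Fin N) (n : ℕ) (k : Fin N) :
    Performs n (torus F (Pi.mulSingle k z * Pi.mulSingle l (star z)))
      ((1 - 1 / Fintype.card (Label N) : ℝ) ^ n) := by
  obtain ⟨O, hO, heig⟩ := hF.eigen
  obtain ⟨σ, hσ, htrans⟩ := hF.permute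
  have hL := card_label_pos hN
  have hL1 : (1 : ℝ) ≤ Fintype.card (Label N) := by exact_mod_cast Nat.cast_pos.1 hL
  have hr0 : (0 : ℝ) ≤ 1 - 1 / Fintype.card (Label N) := by
    rw [sub_nonneg, div_le_one hL]; exact hL1
  have hzz := star_mul_self_of_norm_eq_one hz
  have hcancel : ∀ k, (Pi.mulSingle k z * Pi.mulSingle k (star z) : Fin N → ℂ) = 1 := by
    intro k
    rw [← Pi.mulSingle_mul, mul_comm, hzz, Pi.mulSingle_one]
  induction n generalizing k with
  | zero => exact .giveUp (by simp)
  | succ n ih =>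
    by_cases hkl : k = l
    · subst hkl
      refine .done 1 one_ne_zero ?_ (by positivity)
      rw [hcancel, torus_one hF.unitary, one_smul]
    · obtain ⟨μ, hμ⟩ := heig k
      have hcol : F *ᵥ Pi.single k 1 ≠ 0 := by
        intro h
        have := dotProduct_mulVec_unitary hF.unitary (Pi.single k 1) (Pi.single k 1)
        rw [h] at this
        simp at this
      have hgate : ∀ α, torus F (Pi.mulSingle k z * Pi.mulSingle l (star z)) *
          (inducedGate N (refl (F *ᵥ Pi.single k 1) z) α)ᴴ =
          torus F (Pi.mulSingle (σ α k) z * Pi.mulSingle l (star z)) := by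
        intro α
        obtain ⟨c, hc, h⟩ := hσ α k
        rw [inducedGate_refl, h, refl_smul hc, Matrix.conjTranspose_mul, refl_conjTranspose,
          refl_conjTranspose, star_star, refl_column hF.unitary, refl_column hF.unitary,
          torus_mul hF.unitary, torus_mul hF.unitary]
        congr 1
        calc _ = (Pi.mulSingle k z * Pi.mulSingle k (star z)) *
              (Pi.mulSingle (σ α k) z * Pi.mulSingle l (star z)) := by ring
          _ = _ := by rw [hcancel, one_mul]
      refine .measure (refl (F *ᵥ Pi.single k 1) z)
        ((isElementaryGate_iff N _).2 ⟨O, hO, _, μ, z, hcol, hz, hμ, rfl⟩)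
        (fun α => if σ α k = l then 0 else (1 - 1 / Fintype.card (Label N) : ℝ) ^ n)
        (fun α => ?_) ?_
      · rw [hgate]
        split_ifs with h
        · rw [h, hcancel, torus_one hF.unitary]
          exact .done 1 one_ne_zero (by simp) le_rfl
        · exact ih _
      -- Only one successful label is used; any others can only lower the failure probability.
      · obtain ⟨α₀, hα₀⟩ := htrans k l hkl
        calc _ ≤ ∑ α, if α = α₀ then 0 else (1 - 1 / Fintype.card (Label N) : ℝ) ^ n := by
              refine Finset.sum_le_sum fun α _ => ?_
              by_cases h : α = α₀
              · simp [h, hα₀]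
              · rw [if_neg h]
                split_ifs
                · positivity
                · exact le_rfl
          _ = ∑ α, ((1 - 1 / Fintype.card (Label N) : ℝ) ^ n -
                if α = α₀ then (1 - 1 / Fintype.card (Label N) : ℝ) ^ n else 0) := by
              refine Finset.sum_congr rfl fun α _ => ?_
              split_ifs <;> simp
          _ = (1 - 1 / Fintype.card (Label N) : ℝ) ^ (n + 1) * Fintype.card (Label N) := by
              rw [Finset.sum_sub_distrib]
              simp only [Finset.sum_const, Finset.card_univ, nsmul_eq_mul, Finset.sum_ite_eq',
                Finset.mem_univ, if_true]
              rw [pow_succ]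
              field_simp

lemma IsAxisFrame.pair_mem_performable (hF : IsAxisFrame F) (hN : 2 ≤ N) {z : ℂ} (hz : ‖z‖ = 1)
    (k l : Fin N) :
    torus F (Pi.mulSingle k z * Pi.mulSingle l (star z)) ∈ performable hN := by
  intro ε hε
  have hL := card_label_pos hN
  obtain ⟨n, hn⟩ := exists_pow_lt_of_lt_one hε
    (show (1 - 1 / Fintype.card (Label N) : ℝ) < 1 by
      have := one_div_pos.2 hL; linarith)
  refine ⟨0 + n, ?_⟩
  simpa using (hF.performs_pair hN hz l n k).mono 0 (one_ne_zero (α := ℂ)) hn.le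

/-- The reflections along the columns of an axis frame can be performed. -/
lemma IsAxisFrame.reflects (hF : IsAxisFrame F) (hN : 2 ≤ N) (k : Fin N) :
    Reflects (performable hN) (F *ᵥ Pi.single k 1) := by
  refine ⟨?_, fun w hw => ?_⟩
  · intro h
    have := dotProduct_mulVec_unitary hF.unitary (Pi.single k 1) (Pi.single k 1)
    rw [h] at this
    simp at this
  -- Multiplying the pairs `(k, l)` over all `l` gives `z ^ N` at `k` times `z̄` everywhere. The
  -- scalar `z` removes the latter, which leaves the reflection with phase `z ^ N = w`.
  obtain ⟨z, hzw⟩ := IsAlgClosed.exists_pow_nat_eq w (Nat.pos_of_ne_zero (NeZero.ne N))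
  have hz : ‖z‖ = 1 := by
    rw [← hzw, norm_pow] at hw
    exact (pow_eq_one_iff_of_nonneg (norm_nonneg _) (NeZero.ne N)).1 hw
  have hz0 : z ≠ 0 := by rintro rfl; simp at hz
  have hprod : ∀ s : Finset (Fin N),
      torus F (∏ l ∈ s, (Pi.mulSingle k z * Pi.mulSingle l (star z))) ∈ performable hN := by
    intro s
    induction s using Finset.induction_on with
    | empty => rw [Finset.prod_empty, torus_one hF.unitary]; exact one_mem _
    | insert l s hl ih =>
      rw [Finset.prod_insert hl, ← torus_mul hF.unitary]
      exact mul_mem (hF.pair_mem_performable hN hz k l) ih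
  have hall := smul_mem_performable hN (hprod Finset.univ) hz0
  convert hall using 1
  rw [refl_column hF.unitary, Finset.prod_mul_distrib, Finset.prod_const, Finset.card_univ,
    Fintype.card_fin, Finset.univ_prod_mulSingle (fun _ : Fin N => star z), torus, torus,
    ← smul_mul_assoc, ← mul_smul_comm, ← Matrix.diagonal_smul]
  congr 3
  ext a
  have hzz := star_mul_self_of_norm_eq_one hz
  by_cases hak : a = k
  · subst hak
    simp only [Pi.smul_apply, Pi.mul_apply, Pi.pow_apply, Pi.mulSingle_eq_same, smul_eq_mul, hzw]
    linear_combination -w * hzz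
  · simp only [Pi.smul_apply, Pi.mul_apply, Pi.pow_apply, Pi.mulSingle_eq_of_ne hak, smul_eq_mul,
      one_pow]
    linear_combination -hzz

/-! ### The computational and the Fourier frame -/

/-- The computational basis is an axis frame. -/
lemma isAxisFrame_one : IsAxisFrame (1 : Matrix (Fin N) (Fin N) ℂ) where
  unitary := one_mem _
  eigen := by
    refine ⟨clockZ N, Or.inr ⟨0, by simp⟩, fun k => ⟨rootN N ^ k.val, ?_⟩⟩
    ext l
    rw [Matrix.one_mulVec, clockZ, Matrix.mulVec_diagonal]
    by_cases hl : l = k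
    · subst hl; simp [rootN]
    · simp [hl]
  permute := by
    refine ⟨fun α k => k + α.1.1, fun α k => ?_, fun k l hkl => ?_⟩
    · refine ⟨star (rootN N ^ ((k + α.1.1).val * α.1.2.val)),
        star_ne_zero.2 (pow_ne_zero _ (rootN_ne_zero N)), ?_⟩
      ext b
      rw [Matrix.one_mulVec, Matrix.one_mulVec, Matrix.mulVec_single_one, Matrix.col_apply,
        Matrix.conjTranspose_apply, hw, shiftX_mul_clockZ_apply, ← Fin.val_add]
      by_cases hb : b = k + α.1.1
      · subst hb; simp
      · rw [if_neg (fun h => hb (Fin.ext h))]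
        simp [hb]
    · refine ⟨⟨(l - k, 0), ?_⟩, by simp⟩
      rintro ⟨h, -⟩
      exact hkl (sub_eq_zero.1 (Fin.ext h)).symm

variable (N) in
/-- The discrete Fourier transform. -/
def fourier : Matrix (Fin N) (Fin N) ℂ :=
  ((1 / Real.sqrt N : ℝ) : ℂ) • Matrix.of fun a k => rootN N ^ (a.val * k.val)

omit [NeZero N] in
variable (N) in
lemma fourier_mulVec_single (k : Fin N) :
    fourier N *ᵥ Pi.single k 1 =
      ((1 / Real.sqrt N : ℝ) : ℂ) • fun a : Fin N => rootN N ^ (a.val * k.val) := by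
  ext a
  simp [fourier]

lemma shiftX_pow_mulVec (i : ℕ) (v : Fin N → ℂ) (a : Fin N) :
    (shiftX N ^ i *ᵥ v) a = v (a + Fin.ofNat N i) := by
  rw [Matrix.mulVec, dotProduct, Finset.sum_eq_single (a + Fin.ofNat N i)]
  · rw [shiftX_pow_apply, if_pos, one_mul]
    rw [Fin.val_add, Fin.val_ofNat, Nat.add_mod_mod]
  · intro b _ hb
    rw [shiftX_pow_apply, if_neg, zero_mul]
    intro h
    apply hb
    apply Fin.ext
    rw [h, Fin.val_add, Fin.val_ofNat, Nat.add_mod_mod]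
  · simp

/-- The Fourier basis is an axis frame. -/
lemma isAxisFrame_fourier : IsAxisFrame (fourier N) where
  unitary := by
    rw [Matrix.mem_unitaryGroup_iff', Matrix.star_eq_conjTranspose]
    have hs := sqrt_cast_mul_self N
    have hN0 : (N : ℂ) ≠ 0 := by exact_mod_cast NeZero.ne N
    ext j k
    have h := sum_rootN N j k
    rw [fourier, Matrix.conjTranspose_smul, smul_mul_smul_comm, Matrix.smul_apply, Matrix.mul_apply]
    simp only [Matrix.conjTranspose_apply, Matrix.of_apply]
    rw [h, Matrix.one_apply, Complex.star_def, Complex.conj_ofReal, smul_eq_mul]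
    push_cast
    rw [div_mul_div_comm, hs, one_mul]
    split_ifs
    · field_simp
    · simp
  eigen := by
    refine ⟨shiftX N, Or.inl rfl, fun k => ⟨rootN N ^ k.val, ?_⟩⟩
    rw [fourier_mulVec_single, Matrix.mulVec_smul, smul_comm]
    congr 1
    ext a
    rw [← pow_one (shiftX N), shiftX_pow_mulVec, Pi.smul_apply, smul_eq_mul, ← pow_add, pow_mul,
      Fin.val_add, Fin.val_ofNat, Nat.add_mod_mod, rootN_pow_mod, ← pow_mul]
    ring
  permute := by
    refine ⟨fun α k => k - α.1.2, fun α k => ?_, fun k l hkl => ?_⟩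
    · have h0 := rootN_ne_zero N
      -- Applying `W` to the column that `Wᴴ` should produce is easier; multiplying by `Wᴴ` then
      -- gives the claim.
      have key : hw N α.1 *ᵥ (fourier N *ᵥ Pi.single (k - α.1.2) 1) =
          (rootN N ^ (α.1.1.val * k.val)) • (fourier N *ᵥ Pi.single k 1) := by
        rw [fourier_mulVec_single, fourier_mulVec_single, Matrix.mulVec_smul, smul_comm]
        congr 1
        ext a
        rw [hw, ← Matrix.mulVec_mulVec, shiftX_pow_mulVec, clockZ_pow, Matrix.mulVec_diagonal,
          Pi.smul_apply, smul_eq_mul, ← pow_add, ← pow_add, ← mul_add, ← add_mul]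
        have h1 : (α.1.2 + (k - α.1.2) : Fin N).val = (α.1.2.val + (k - α.1.2).val) % N :=
          Fin.val_add _ _
        rw [add_sub_cancel] at h1
        rw [mul_comm _ (α.1.2.val + _), pow_mul, ← rootN_pow_mod N (α.1.2.val + _), ← h1, ← pow_mul,
          mul_comm, pow_mul, Fin.val_add, Fin.val_ofNat, Nat.add_mod_mod, rootN_pow_mod, ← pow_mul,
          add_comm]
      refine ⟨(rootN N ^ (α.1.1.val * k.val))⁻¹, inv_ne_zero (pow_ne_zero _ h0), ?_⟩
      have := congrArg (fun v => (hw N α.1)ᴴ *ᵥ v) key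
      simp only [Matrix.mulVec_smul] at this
      rw [Matrix.mulVec_mulVec, conjTranspose_hw_mul, Matrix.one_mulVec] at this
      rw [this, smul_smul, inv_mul_cancel₀ (pow_ne_zero _ h0), one_smul]
    · refine ⟨⟨(0, k - l), ?_⟩, by simp⟩
      rintro ⟨-, h⟩
      exact hkl (sub_eq_zero.1 (Fin.ext h))

/-! ### Universality -/

/-- Every unitary matrix can be performed. -/
lemma unitary_mem_performable (hN : 2 ≤ N) {T : Matrix (Fin N) (Fin N) ℂ}
    (hT : T ∈ Matrix.unitaryGroup (Fin N) ℂ) : T ∈ performable hN := by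
  refine unitary_mem_of_reflects (fun w hw => ?_) hT
  refine Reflects.of_single_of_one (fun i => ?_) ?_ hw
  · have h := isAxisFrame_one.reflects hN i
    rwa [Matrix.one_mulVec] at h
  -- The Fourier column `0` is proportional to `(1, …, 1)`, the one direction needed besides the
  -- coordinate axes.
  · have h := isAxisFrame_fourier.reflects hN (0 : Fin N)
    rw [fourier_mulVec_single] at h
    have h1 : (fun a : Fin N => rootN N ^ (a.val * (0 : Fin N).val)) = 1 := by ext a; simp
    rw [h1] at h
    refine h.of_smul ?_
    have := sqrt_cast_ne_zero N
    push_cast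
    exact one_div_ne_zero this

open Classical in
/-- Every unitary matrix is performed, up to a known byproduct, with probability arbitrarily close
to `1` on a long enough chain. -/
lemma exists_protocol (hN : 2 ≤ N) {T : Matrix (Fin N) (Fin N) ℂ}
    (hT : T ∈ Matrix.unitaryGroup (Fin N) ℂ) {ε : ℝ} (hε : 0 < ε) :
    ∃ (P : GateProtocol N) (n : ℕ) (S : Finset (Fin n → Label N))
      (b : (Fin n → Label N) → Fin N × Fin N),
      (∀ o ∈ S, ∃ c : ℂ, c ≠ 0 ∧
        ∀ ψ, postState N n P.basis ψ o = c • ((hw N (b o) * T) *ᵥ ψ)) ∧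
      ∀ ψ : Fin N → ℂ, ∑ e, ‖ψ e‖ ^ 2 = 1 → 1 - ε ≤ ∑ o ∈ S, prob N n P.basis ψ o := by
  obtain ⟨n, hn⟩ := unitary_mem_performable hN hT ε hε
  obtain ⟨s, hs, hbound⟩ := hn.exists_strategy
  refine ⟨correctedProtocol s hs, n,
    Finset.univ.filter fun o => ∃ c : ℂ, c ≠ 0 ∧ effOp s (List.ofFn o) = c • T,
    fun o => byproduct (List.ofFn o), fun o ho => ?_, fun ψ hψ => ?_⟩
  · obtain ⟨c, hc, h⟩ := (Finset.mem_filter.1 ho).2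
    obtain ⟨c', hc', h'⟩ := correctedProtocol_virtualOp hN s hs n o
    refine ⟨c' * c, mul_ne_zero hc' hc, fun ψ => ?_⟩
    rw [postState_eq_virtualOp_mulVec N hN, h', h, mul_smul_comm, smul_smul, Matrix.smul_mulVec]
  · rw [Finset.sum_congr rfl fun o _ => GateProtocol.prob_eq _ hN n ψ hψ o, Finset.sum_filter]
    have hL := card_label_pos hN
    have hcard : (Fintype.card (Label N) : ℝ) = (N : ℝ) ^ 2 - 1 := by
      rw [card_label, Nat.cast_sub (Nat.one_le_pow _ _ (by omega))]
      push_cast; ring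
    rw [← hcard]
    have hsum : ∑ o : Fin n → Label N,
        (if ∃ c : ℂ, c ≠ 0 ∧ effOp s (List.ofFn o) = c • T then
          (1 / (Fintype.card (Label N) : ℝ)) ^ n else 0) =
        (1 / (Fintype.card (Label N) : ℝ)) ^ n * ∑ o : Fin n → Label N,
          (1 - if ∃ c : ℂ, c ≠ 0 ∧ effOp s (List.ofFn o) = c • T then (0 : ℝ) else 1) := by
      rw [Finset.mul_sum]
      refine Finset.sum_congr rfl fun o _ => ?_
      split_ifs <;> simp
    rw [hsum, Finset.sum_sub_distrib]
    simp only [Finset.sum_const, Finset.card_univ, Fintype.card_pi, Finset.prod_const,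
      Fintype.card_fin, nsmul_eq_mul, mul_one, Nat.cast_pow]
    have hLn : 0 < (Fintype.card (Label N) : ℝ) ^ n := pow_pos hL n
    rw [one_div, inv_pow, ← div_eq_inv_mul, le_div_iff₀ hLn]
    linarith

end Schemes

end AKLT

end

/-! ### The theorem -/

open Classical in
theorem proposition3 (N : ℕ) (hN : 2 ≤ N) :
    -- the AKLT state is normalized
    (∀ (n : ℕ) (ψ : Fin N → ℂ), ∑ e, ‖ψ e‖ ^ 2 = 1 →
      ∑ s, ∑ e, ‖AKLT.akltState N n ψ s e‖ ^ 2 = 1) ∧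
    -- adaptive on-site measurements act on the virtual space by products of Kraus operators
    (∀ (n : ℕ) (B : List (AKLT.Label N) → AKLT.SiteBasis N) (ψ : Fin N → ℂ)
      (o : Fin n → AKLT.Label N),
      AKLT.postState N n B ψ o = AKLT.virtualOp N n B o *ᵥ ψ) ∧
    -- in a suitable on-site basis the Kraus operators are the Gell-Mann matrices, and a unitary
    -- rotation turns them into the Heisenberg–Weyl operators
    (∃ M : AKLT.SiteBasis N,
      (∀ β, (M β : AKLT.PairSpace N) = AKLT.toPair N ((Real.sqrt 2 : ℂ) • AKLT.gellMann N β)) ∧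
      (∀ β, AKLT.kraus N (M β) =
        ((Real.sqrt (2 * N / ((N : ℝ) ^ 2 - 1)) : ℝ) : ℂ) • AKLT.gellMann N β) ∧
      ∃ U ∈ Matrix.unitaryGroup (AKLT.Label N) ℂ, ∀ α,
        ∑ β, U α β • AKLT.kraus N (M β) =
          ((1 / Real.sqrt ((N : ℝ) ^ 2 - 1) : ℝ) : ℂ) • AKLT.hw N α.1) ∧
    -- the Heisenberg–Weyl operators are unitary, and the basis rotated by `V` exists and induces
    -- the operators `V† W V`
    (∀ p, AKLT.hw N p ∈ Matrix.unitaryGroup (Fin N) ℂ) ∧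
    (∀ V ∈ Matrix.unitaryGroup (Fin N) ℂ,
      (∃ B : AKLT.SiteBasis N, AKLT.IsRotatedBy N V B) ∧
      ∀ B : AKLT.SiteBasis N, AKLT.IsRotatedBy N V B → ∀ α,
        AKLT.kraus N (B α) =
          ((1 / Real.sqrt ((N : ℝ) ^ 2 - 1) : ℝ) : ℂ) • (Vᴴ * AKLT.hw N α.1 * V) ∧
        AKLT.kraus N (B α) =
          ((1 / Real.sqrt ((N : ℝ) ^ 2 - 1) : ℝ) : ℂ) •
            (AKLT.hw N α.1 * AKLT.inducedGate N V α)) ∧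
    -- the outcomes are uniformly distributed, and every sequence of outcomes performs some gate of
    -- `SU(N)`, up to a Heisenberg–Weyl byproduct
    (∀ (P : AKLT.GateProtocol N) (n : ℕ) (o : Fin n → AKLT.Label N),
      (∀ ψ : Fin N → ℂ, ∑ e, ‖ψ e‖ ^ 2 = 1 →
        AKLT.prob N n P.basis ψ o = (1 / ((N : ℝ) ^ 2 - 1)) ^ n) ∧
      ∃ G ∈ Matrix.specialUnitaryGroup (Fin N) ℂ, ∃ (b : Fin N × Fin N) (c : ℂ), c ≠ 0 ∧
        ∀ ψ, AKLT.postState N n P.basis ψ o = c • ((AKLT.hw N b * G) *ᵥ ψ)) ∧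
    -- a single measurement induces a gate of `SU(N)`; the gate is the identity (failure) or
    -- nontrivial (success), the latter with conditional probability `N / (N + 1)`
    (∀ V, AKLT.IsElementaryGate N V → ∀ α : AKLT.Label N,
      AKLT.inducedGate N V α ∈ Matrix.specialUnitaryGroup (Fin N) ℂ ∧
      (AKLT.inducedGate N V α = 1 ↔ Commute V (AKLT.hw N α.1)) ∧
      ((2 < N ∨ V * V ≠ 1) → AKLT.inducedGate N V α ≠ 1 →
        ∀ z : ℂ, AKLT.inducedGate N V α ≠ z • 1)) ∧
    (∀ (P : AKLT.GateProtocol N) (n : ℕ) (o : Fin n → AKLT.Label N) (ψ : Fin N → ℂ),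
      ∑ e, ‖ψ e‖ ^ 2 = 1 → P.gate (List.ofFn o) ≠ 1 →
      ∑ α with AKLT.inducedGate N (P.gate (List.ofFn o)) α ≠ 1,
          AKLT.prob N (n + 1) P.basis ψ (Fin.snoc o α) =
        (N / (N + 1) : ℝ) * AKLT.prob N n P.basis ψ o) ∧
    -- every gate of `SU(N)` is performed, up to a known Heisenberg–Weyl byproduct, with probability
    -- arbitrarily close to `1` on a long enough chain
    (∀ T ∈ Matrix.specialUnitaryGroup (Fin N) ℂ, ∀ ε : ℝ, 0 < ε →
      ∃ (P : AKLT.GateProtocol N) (n : ℕ) (S : Finset (Fin n → AKLT.Label N))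
        (b : (Fin n → AKLT.Label N) → Fin N × Fin N),
        (∀ o ∈ S, ∃ c : ℂ, c ≠ 0 ∧
          ∀ ψ, AKLT.postState N n P.basis ψ o = c • ((AKLT.hw N (b o) * T) *ᵥ ψ)) ∧
        ∀ ψ : Fin N → ℂ, ∑ e, ‖ψ e‖ ^ 2 = 1 →
          1 - ε ≤ ∑ o ∈ S, AKLT.prob N n P.basis ψ o) := by
  have : NeZero N := ⟨by omega⟩
  have hpos := AKLT.natCast_sq_sub_one_pos hN
  refine ⟨fun n ψ hψ => ?_, AKLT.postState_eq_virtualOp_mulVec N hN, ?_,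
    AKLT.hw_mem_unitaryGroup N, fun V hV => ⟨AKLT.exists_rotated N hV, fun B hB α => ?_⟩,
    fun P n o => ⟨fun ψ hψ => P.prob_eq hN n ψ hψ o, ?_⟩, fun V hV α => ?_,
    fun P n o ψ hψ hP => ?_, fun T hT ε hε => ?_⟩
  · rw [AKLT.sum_norm_akltState N hN, hψ]
  · obtain ⟨M, hM⟩ := AKLT.exists_gellMann_basis N
    obtain ⟨B, hB⟩ := AKLT.exists_rotated N (one_mem (Matrix.unitaryGroup (Fin N) ℂ))
    obtain ⟨U, hU, hUM⟩ := AKLT.exists_unitary_kraus N B M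
    refine ⟨M, hM, fun β => by rw [hM, AKLT.kraus_gellMann], U, hU, fun α => ?_⟩
    rw [hUM, AKLT.kraus_of_isRotatedBy N hN hB, Matrix.conjTranspose_one, one_mul, mul_one]
  · rw [AKLT.hw_mul_inducedGate]
    exact ⟨AKLT.kraus_of_isRotatedBy N hN hB α, AKLT.kraus_of_isRotatedBy N hN hB α⟩
  · obtain ⟨G, hG, b, c, hc, h⟩ := P.exists_virtualOp_eq hN n o
    refine ⟨G, hG, b, c, hc, fun ψ => ?_⟩
    rw [AKLT.postState_eq_virtualOp_mulVec N hN, h, Matrix.smul_mulVec]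
  · exact ⟨AKLT.inducedGate_mem_specialUnitaryGroup hV.mem_unitaryGroup α,
      AKLT.inducedGate_eq_one_iff_commute hV.mem_unitaryGroup α,
      fun h hne => hV.inducedGate_not_scalar α h hne⟩
  -- There are `N² - N` nontrivial outcomes, each of conditional probability `1 / (N² - 1)`, and
  -- `(N² - N) / (N² - 1) = N / (N + 1)`.
  · rw [Finset.sum_congr rfl fun α _ => P.prob_snoc hN n ψ o α, Finset.sum_const,
      (P.elementary _).card_nontrivial hP, nsmul_eq_mul,
      Nat.cast_sub (Nat.le_self_pow two_ne_zero N), Nat.cast_pow, ← mul_assoc]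
    congr 1
    have h1 : (N : ℝ) + 1 ≠ 0 := by positivity
    field_simp
    ring
  · exact AKLT.exists_protocol hN (Matrix.specialUnitaryGroup_le_unitaryGroup hT) hε
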